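/- Let $n\ge 2$ and $r\ge 1$ be integers, and let $\mathfrak{C}_{n,r}=\{1,\dots,r\}\times\{1,\dots,n\}^{\omega}$ be the Cantor space of infinite sequences whose first digit lies in $\{1,\dots,r\}$ and whose remaining digits lie in $\{1,\dots,n\}$. For a finite prefix $\alpha\in\{1,\dots,r\}\times\{1,\dots,n\}^{*}$ the cone $C_\alpha$ is the set of all sequences with prefix $\alpha$. The Higman--Thompson group $V_{n,r}$ is the group of all homeomorphisms $f$ of $\mathfrak{C}_{n,r}$ such that every point lies in a cone $C_\alpha$ on which $f$ is a prefix replacement $\alpha\psi\mapsto\beta\psi$ for some finite prefix $\beta$. A point of $\mathfrak{C}_{n,r}$ is rational if its sequence of digits is eventually repeating. For $S\subseteq\mathfrak{C}_{n,r}$, let $\mathrm{Fix}(S)\le V_{n,r}$ be the subgroup of elements fixing every point of $S$; for a point $p$, let $\mathrm{Fix}_0(p)\trianglelefteq\mathrm{Fix}(p)$ be the subgroup of elements that are the identity in a neighborhood of $p$. The group of germs at $p$ is $(V_{n,r})_p=\mathrm{Fix}(p)/\mathrm{Fix}_0(p)$, and $(f)_p$ denotes the image of $f\in\mathrm{Fix}(p)$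 in it. **Theorem.** Let $S\subseteq\mathfrak{C}_{n,r}$ be a finite (possibly empty) set of rational points. Then $$\mathrm{Fix}(S)\big/[\mathrm{Fix}(S),\mathrm{Fix}(S)]\;\cong\;\begin{cases}\mathbb{Z}^{|S|} & \text{if $n$ is even,}\\ \mathbb{Z}^{|S|}\oplus\mathbb{Z}/2\mathbb{Z} & \text{if $n$ is odd.}\end{cases}$$ More precisely, let $A=V_{n,r}/[V_{n,r},V_{n,r}]$ and let $\rho\colon V_{n,r}\to A$ be the quotient map. Then the homomorphism $$\mathrm{Fix}(S)\to\prod_{s\in S}(V_{n,r})_s\times A,\qquad f\mapsto\bigl(((f)_s)_{s\in S},\,\rho(f)\bigr)$$ induces an isomorphism $\mathrm{Fix}(S)/[\mathrm{Fix}(S),\mathrm{Fix}(S)]\cong\prod_{s\in S}(V_{n,r})_s\times A$. Here each group of germs $(V_{n,r})_s$, $s\in S$, is infinite cyclic, and $A$ is trivial if $n$ is even and cyclic of order two if $n$ is odd. -/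

import Mathlib

open Topology

namespace HigmanThompson

/-- The Cantor space `{1,…,r} × {1,…,n}^ω` of infinite sequences whose first digit lies in an
`r`-element alphabet and whose remaining digits lie in an `n`-element alphabet, with the product
of the discrete topologies. -/
abbrev CantorSpace (n r : ℕ) : Type := Fin r × (ℕ → Fin n)

/-- Finite prefixes, i.e. the elements of `{1,…,r} × {1,…,n}^*`. -/
abbrev FinPrefix (n r : ℕ) : Type := Fin r × List (Fin n)

/-- The infinite sequence `αψ` obtained by concatenating the finite prefix `α` with the infinite
tail `ψ`. -/
def prepend {n r : ℕ} (α : FinPrefix n r) (ψ : ℕ → Fin n) : CantorSpace n r :=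
  (α.1, fun k => if h : k < α.2.length then α.2[k] else ψ (k - α.2.length))

/-- The cone `C_α`: all sequences having `α` as a prefix. -/
def cone {n r : ℕ} (α : FinPrefix n r) : Set (CantorSpace n r) := Set.range (prepend α)

/-- A self-map of the Cantor space is Thompson-like if every point lies in some cone `C_α` on which
the map restricts to a prefix replacement `αψ ↦ βψ`. -/
def IsThompsonLike {n r : ℕ} (f : CantorSpace n r → CantorSpace n r) : Prop :=
  ∀ x, ∃ α β : FinPrefix n r, x ∈ cone α ∧ ∀ ψ, f (prepend α ψ) = prepend β ψ

theorem prepend_append {n r : ℕ} (a : Fin r) (v w : List (Fin n)) (ψ : ℕ → Fin n) :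
    prepend (a, v ++ w) ψ = prepend (a, v) (prepend (a, w) ψ).2 := by
  refine Prod.ext rfl (funext fun k => ?_)
  simp only [prepend, List.length_append]
  by_cases h1 : k < v.length
  · rw [dif_pos h1, dif_pos (by omega), List.getElem_append_left h1]
  · rw [dif_neg h1]
    by_cases h2 : k < v.length + w.length
    · rw [dif_pos h2, dif_pos (by omega), List.getElem_append_right (by omega)]
    · rw [dif_neg h2, dif_neg (by omega)]
      congr 1
      omega

theorem prepend_ofFn {n r : ℕ} (x : CantorSpace n r) (m : ℕ) :
    prepend (x.1, List.ofFn fun i : Fin m => x.2 i) (fun k => x.2 (k + m)) = x := by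
  refine Prod.ext rfl (funext fun k => ?_)
  simp only [prepend, List.length_ofFn]
  by_cases h : k < m
  · rw [dif_pos h, List.getElem_ofFn]
  · rw [dif_neg h, Nat.sub_add_cancel (not_lt.1 h)]

/-- If `βψ` has the prefix `γ`, where `β` is at least as long as `γ`, then `β` extends `γ`. -/
theorem exists_append_of_prepend_eq {n r : ℕ} {β γ : FinPrefix n r} {ψ φ : ℕ → Fin n}
    (h : prepend β ψ = prepend γ φ) (hl : γ.2.length ≤ β.2.length) :
    ∃ v : List (Fin n), β = (γ.1, γ.2 ++ v) := by
  have h1 : β.1 = γ.1 := (Prod.ext_iff.1 h).1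
  have h2 : γ.2 <+: β.2 := by
    rw [List.prefix_iff_eq_take]
    apply List.ext_getElem
    · simp [hl]
    · intro k hk hk'
      have := congrFun (congrArg Prod.snd h) k
      simp only [prepend] at this
      rw [dif_pos hk, dif_pos (by omega)] at this
      simp [this]
  obtain ⟨v, hv⟩ := h2
  exact ⟨v, Prod.ext h1 hv.symm⟩

theorem IsThompsonLike.comp {n r : ℕ} {f g : CantorSpace n r → CantorSpace n r}
    (hf : IsThompsonLike f) (hg : IsThompsonLike g) : IsThompsonLike (f ∘ g) := by
  intro x
  obtain ⟨α, β, ⟨ψ, rfl⟩, hgα⟩ := hg x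
  obtain ⟨γ, δ, ⟨φ, hφ⟩, hfγ⟩ := hf (g (prepend α ψ))
  rw [hgα] at hφ
  set m := γ.2.length with hm
  set w : List (Fin n) := List.ofFn fun i : Fin m => ψ i
  set ψ' : ℕ → Fin n := fun k => ψ (k + m)
  have hψ : ∀ a : Fin r, (prepend (a, w) ψ').2 = ψ :=
    fun a => congrArg Prod.snd (prepend_ofFn (a, ψ) m)
  have hβ : prepend (β.1, β.2 ++ w) ψ' = prepend γ φ := by
    rw [prepend_append, hψ, hφ]
  obtain ⟨v, hv⟩ := exists_append_of_prepend_eq hβ (by simp [w, hm])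
  refine ⟨(α.1, α.2 ++ w), (δ.1, δ.2 ++ v), ⟨ψ', by rw [prepend_append, hψ]⟩, fun χ => ?_⟩
  have key : g (prepend (α.1, α.2 ++ w) χ) = prepend (β.1, β.2 ++ w) χ := by
    rw [prepend_append, hgα, prepend_append]
    rfl
  rw [Function.comp_apply, key, hv, prepend_append, hfγ, prepend_append]
  rfl

/-- The Higman–Thompson group `V_{n,r}` of all Thompson-like homeomorphisms of the Cantor space,
with composition as multiplication. -/
def V (n r : ℕ) : Subgroup (CantorSpace n r ≃ₜ CantorSpace n r) where
  carrier := {f | IsThompsonLike f}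
  mul_mem' hf hg := IsThompsonLike.comp hf hg
  one_mem' x := ⟨(x.1, []), (x.1, []), ⟨x.2, prepend_ofFn x 0⟩, fun _ => rfl⟩
  inv_mem' {f} hf y := by
    obtain ⟨α, β, ⟨ψ, hψ⟩, h⟩ := hf (f.symm y)
    refine ⟨β, α, ⟨ψ, ?_⟩, fun φ => ?_⟩
    · rw [← h ψ, hψ]
      exact f.apply_symm_apply y
    · rw [← h φ]
      exact f.symm_apply_apply _

/-- A point is rational if its sequence of digits is eventually repeating. -/
def IsRational {n r : ℕ} (x : CantorSpace n r) : Prop :=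
  ∃ N p : ℕ, 0 < p ∧ ∀ k, N ≤ k → x.2 (k + p) = x.2 k

theorem inv_apply_eq_self {n r : ℕ} {f : V n r} {x : CantorSpace n r} (h : f.1 x = x) :
    (f⁻¹).1 x = x := by
  have : f.1.symm (f.1 x) = x := f.1.symm_apply_apply x
  rw [h] at this
  exact this

/-- The pointwise stabilizer `Fix(S)` of `S` in `V_{n,r}`. -/
def fixGroup {n r : ℕ} (S : Set (CantorSpace n r)) : Subgroup (V n r) where
  carrier := {f | ∀ x ∈ S, f.1 x = x}
  mul_mem' {f g} hf hg x hx := by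
    change f.1 (g.1 x) = x
    rw [hg x hx, hf x hx]
  one_mem' _ _ := rfl
  inv_mem' hf x hx := inv_apply_eq_self (hf x hx)

/-- The subgroup `Fix₀(S)` of the elements of `V_{n,r}` that are the identity in some neighborhood
of `S`. -/
def fixGroup₀ {n r : ℕ} (S : Set (CantorSpace n r)) : Subgroup (V n r) where
  carrier := {f | ∀ᶠ x in 𝓝ˢ S, f.1 x = x}
  mul_mem' {f g} hf hg := by
    have hf' : ∀ᶠ x in 𝓝ˢ S, f.1 x = x := hf
    have hg' : ∀ᶠ x in 𝓝ˢ S, g.1 x = x := hg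
    change ∀ᶠ x in 𝓝ˢ S, (f * g).1 x = x
    filter_upwards [hf', hg'] with x hfx hgx
    change f.1 (g.1 x) = x
    rw [hgx, hfx]
  one_mem' := by
    change ∀ᶠ x in 𝓝ˢ S, x = x
    exact Filter.Eventually.of_forall fun _ => rfl
  inv_mem' {f} hf := by
    have hf' : ∀ᶠ x in 𝓝ˢ S, f.1 x = x := hf
    exact hf'.mono fun _ hx => inv_apply_eq_self hx

instance normal_fixGroup₀ {n r : ℕ} (S : Set (CantorSpace n r)) :
    ((fixGroup₀ S).subgroupOf (fixGroup S)).Normal where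
  conj_mem f hf g := by
    have hg : Filter.Tendsto g.1.1.symm (𝓝ˢ S) (𝓝ˢ S) :=
      g.1.1.symm.continuous.tendsto_nhdsSet fun x hx => by
        have h : g.1.1.symm x = x := inv_apply_eq_self (g.2 x hx)
        rw [h]
        exact hx
    have hf' : ∀ᶠ x in 𝓝ˢ S, f.1.1 x = x := hf
    change ∀ᶠ x in 𝓝ˢ S, g.1.1 (f.1.1 (g.1.1.symm x)) = x
    filter_upwards [hg.eventually hf'] with x hx
    rw [hx]
    exact g.1.1.apply_symm_apply x

/-- The group of germs `(V_{n,r})_p = Fix(p) / Fix₀(p)` at the point `p`. -/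
abbrev GermGroup {n r : ℕ} (p : CantorSpace n r) : Type :=
  fixGroup {p} ⧸ (fixGroup₀ {p}).subgroupOf (fixGroup {p})

/-- For `p ∈ S`, the homomorphism `Fix(S) → (V_{n,r})_p` sending `f` to its germ `(f)_p`. -/
def germ {n r : ℕ} (S : Set (CantorSpace n r)) (p : S) : fixGroup S →* GermGroup (p : CantorSpace n r) :=
  (QuotientGroup.mk' _).comp <| Subgroup.inclusion (H := fixGroup S) (K := fixGroup {p.1})
    fun f hf x hx => hf x (by rw [Set.mem_singleton_iff.1 hx]; exact p.2)

end HigmanThompson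

/-!
The proof rests on transpositions: for prefixes `α`, `β` with disjoint cones, `swap α β` exchanges
`αψ` and `βψ` and fixes all other points.

*Generation* (`mem_closure_swapsIn_compl`). An element of `V` that is the identity near a finite set
`S` is a product of transpositions of cones disjoint from `S`. It is described by a bijection
between two partitions into cones of a clopen set `Y` that is the union of the cones of some depth
`L` disjoint from `S`. If the partitions are not both the partition into cones of depth `L`, each of
them contains all children of some prefix; transpositions match these two families of children, and
the description becomes smaller.

*Classes* (`map_fixSwap_of_even`, `map_fixSwap_eq_of_odd`). If three cones are disjoint, two
transpositions among them are conjugate. A transposition is also the product of the `n`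
transpositions of corresponding children, which are conjugate to each other. As a transposition is
an involution, its class `τ` in an abelian quotient of `Fix(S)` is trivial for even `n`. For odd `n`
it equals the class of the transposition of two children, and it follows that all transpositions
have the same class, of order at most two.

*Sign* (`sign`, `sign_swap_ne_one`). For odd `n`, giving each cone the mass one in `ℤ/2` defines a
finitely additive measure on the clopen sets, which `V` preserves. The sign of `f` is the mass of
the set of inversions `{(x, y) | x < y, f(x) > f(y)}` for the lexicographic order. It is a
homomorphism for the same reason as for finite permutations, and it is nontrivial on a transposition
of two adjacent cones. So the abelianization of `V` is trivial for even `n` and of order two for odd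
`n`.

*Germs* (`ker_driftHom`, `exists_germ_eq`). Near a fixed point `p`, an element replaces the prefix
of length `a` of `p` by the one of length `b`. The difference `b - a` determines the germ, and it
takes nonzero values because `p` is rational, so the group of germs is infinite cyclic. Each germ
is that of a product of two transpositions supported in an arbitrarily small cone around `p`.

The last statement makes `germsHom` surjective. An element of its kernel is the identity near `S`,
hence a product of transpositions away from `S`. Its class in the abelianization of `Fix(S)` is
trivial or, for odd `n`, possibly that of one transposition; the latter is excluded by its image in
the abelianization of `V`, where a transposition has a nontrivial class.
-/

namespace HigmanThompson

variable {n r : ℕ}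

/-! ### Prefixes and cones -/

/-- The prefix of length `N` (not counting the first digit) of a point of the Cantor space. -/
def pre (N : ℕ) (x : CantorSpace n r) : FinPrefix n r :=
  (x.1, List.ofFn fun i : Fin N => x.2 i)

/-- What is left of a point when its prefix of length `N` is removed. -/
def tail (N : ℕ) (x : CantorSpace n r) : ℕ → Fin n := fun k => x.2 (k + N)

/-- The concatenation of a finite prefix with a word. -/
def app (α : FinPrefix n r) (w : List (Fin n)) : FinPrefix n r := (α.1, α.2 ++ w)

/-- The concatenation of a word with an infinite sequence. -/
def wapp (w : List (Fin n)) (ψ : ℕ → Fin n) : ℕ → Fin n :=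
  fun k => if h : k < w.length then w[k] else ψ (k - w.length)

@[simp] theorem pre_length (N : ℕ) (x : CantorSpace n r) : (pre N x).2.length = N := by
  simp [pre]

@[simp] theorem app_length (α : FinPrefix n r) (w : List (Fin n)) :
    (app α w).2.length = α.2.length + w.length := by
  simp [app]

@[simp] theorem app_nil (α : FinPrefix n r) : app α [] = α := by
  simp [app]

theorem app_app (α : FinPrefix n r) (v w : List (Fin n)) : app (app α v) w = app α (v ++ w) := by
  simp [app]

theorem app_injective (α : FinPrefix n r) : Function.Injective (app α) := fun v w h => by
  simpa [app] using h

theorem prepend_pre_tail (N : ℕ) (x : CantorSpace n r) : prepend (pre N x) (tail N x) = x :=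
  prepend_ofFn x N

theorem prepend_app (α : FinPrefix n r) (w : List (Fin n)) (ψ : ℕ → Fin n) :
    prepend (app α w) ψ = prepend α (wapp w ψ) :=
  prepend_append α.1 α.2 w ψ

theorem prepend_snd_of_lt (α : FinPrefix n r) (ψ : ℕ → Fin n) {k : ℕ} (hk : k < α.2.length) :
    (prepend α ψ).2 k = α.2[k] := by
  simp [prepend, hk]

theorem prepend_snd_add (α : FinPrefix n r) (ψ : ℕ → Fin n) (k : ℕ) :
    (prepend α ψ).2 (k + α.2.length) = ψ k := by
  simp [prepend]

theorem tail_prepend (α : FinPrefix n r) (ψ : ℕ → Fin n) :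
    tail α.2.length (prepend α ψ) = ψ :=
  funext fun k => prepend_snd_add α ψ k

theorem pre_prepend (α : FinPrefix n r) (ψ : ℕ → Fin n) :
    pre α.2.length (prepend α ψ) = α := by
  refine Prod.ext rfl ?_
  apply List.ext_getElem
  · simp [pre]
  · intro k h1 h2
    simp [pre, prepend_snd_of_lt α ψ h2]

theorem prepend_injective (α : FinPrefix n r) : Function.Injective (prepend α) := fun ψ φ h => by
  rw [← tail_prepend α ψ, h, tail_prepend]

theorem pre_prepend_of_le {N : ℕ} {α : FinPrefix n r} (h : N ≤ α.2.length) (ψ : ℕ → Fin n) :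
    pre N (prepend α ψ) = (α.1, α.2.take N) := by
  refine Prod.ext rfl ?_
  apply List.ext_getElem
  · simp [pre, h]
  · intro k h1 h2
    have h3 : k < α.2.length := by
      simp at h2
      omega
    simp [pre, prepend, h3]

theorem pre_eq_iff {N : ℕ} {x y : CantorSpace n r} :
    pre N x = pre N y ↔ x.1 = y.1 ∧ ∀ k < N, x.2 k = y.2 k := by
  simp only [pre, Prod.mk.injEq, List.ofFn_inj, funext_iff, Fin.forall_iff]

theorem pre_eq_of_le {M N : ℕ} (h : M ≤ N) {x y : CantorSpace n r} (hxy : pre N x = pre N y) :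
    pre M x = pre M y := by
  rw [pre_eq_iff] at *
  exact ⟨hxy.1, fun k hk => hxy.2 k (by omega)⟩

theorem pre_add (M N : ℕ) (x : CantorSpace n r) :
    ∃ w : List (Fin n), w.length = N ∧ pre (M + N) x = app (pre M x) w := by
  refine ⟨List.ofFn fun i : Fin N => x.2 (M + i), by simp, Prod.ext rfl ?_⟩
  simp [pre, app, List.ofFn_add]

theorem mem_cone_iff {α : FinPrefix n r} {x : CantorSpace n r} :
    x ∈ cone α ↔ pre α.2.length x = α := by
  constructor
  · rintro ⟨ψ, rfl⟩
    exact pre_prepend α ψ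
  · intro h
    exact ⟨tail α.2.length x, by conv_rhs => rw [← prepend_pre_tail α.2.length x, h]⟩

theorem prepend_mem_cone (α : FinPrefix n r) (ψ : ℕ → Fin n) : prepend α ψ ∈ cone α := ⟨ψ, rfl⟩

theorem mem_cone_pre (N : ℕ) (x : CantorSpace n r) : x ∈ cone (pre N x) :=
  ⟨tail N x, prepend_pre_tail N x⟩

theorem mem_cone_pre_iff {N : ℕ} {x y : CantorSpace n r} :
    y ∈ cone (pre N x) ↔ pre N y = pre N x := by
  rw [mem_cone_iff, pre_length]

theorem prepend_tail_of_mem {α : FinPrefix n r} {x : CantorSpace n r} (h : x ∈ cone α) :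
    prepend α (tail α.2.length x) = x := by
  obtain ⟨ψ, rfl⟩ := h
  rw [tail_prepend]

theorem cone_app_subset (α : FinPrefix n r) (w : List (Fin n)) : cone (app α w) ⊆ cone α := by
  rintro _ ⟨ψ, rfl⟩
  exact ⟨_, (prepend_app α w ψ).symm⟩

theorem exists_eq_app {α β : FinPrefix n r} {x : CantorSpace n r} (hα : x ∈ cone α)
    (hβ : x ∈ cone β) (hl : α.2.length ≤ β.2.length) : ∃ w, β = app α w := by
  obtain ⟨ψ, rfl⟩ := hα
  obtain ⟨φ, hφ⟩ := hβ
  exact exists_append_of_prepend_eq hφ hl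

theorem eq_of_mem_cone {α β : FinPrefix n r} {x : CantorSpace n r} (hα : x ∈ cone α)
    (hβ : x ∈ cone β) (hl : α.2.length = β.2.length) : α = β := by
  rw [mem_cone_iff] at hα hβ
  rw [← hα, ← hβ, hl]

theorem disjoint_of_length_eq {α β : FinPrefix n r} (hl : α.2.length = β.2.length) (h : α ≠ β) :
    Disjoint (cone α) (cone β) :=
  Set.disjoint_left.2 fun _ h1 h2 => h (eq_of_mem_cone h1 h2 hl)

theorem disjoint_app {α β : FinPrefix n r} (h : Disjoint (cone α) (cone β))
    (v w : List (Fin n)) : Disjoint (cone (app α v)) (cone (app β w)) :=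
  h.mono (cone_app_subset _ _) (cone_app_subset _ _)

theorem disjoint_child (α : FinPrefix n r) {j k : Fin n} (h : j ≠ k) :
    Disjoint (cone (app α [j])) (cone (app α [k])) :=
  disjoint_of_length_eq (by simp) fun e => h (by simpa using app_injective α e)

theorem cone_nonempty (hn : 2 ≤ n) (α : FinPrefix n r) : (cone α).Nonempty :=
  ⟨_, prepend_mem_cone α fun _ => ⟨0, by omega⟩⟩

/-- A prefix is determined by the prefix replacement it induces: this is where a second letter in
the alphabet is needed. -/
theorem eq_of_prepend_eq (hn : 2 ≤ n) {α β : FinPrefix n r}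
    (h : ∀ ψ, prepend α ψ = prepend β ψ) : α = β := by
  have key : ∀ {α β : FinPrefix n r}, (∀ ψ, prepend α ψ = prepend β ψ) →
      β.2.length ≤ α.2.length := by
    intro α β h
    by_contra! hl
    have h0 := congrFun (congrArg Prod.snd (h fun _ => ⟨0, by omega⟩)) (0 + α.2.length)
    have h1 := congrFun (congrArg Prod.snd (h fun _ => ⟨1, by omega⟩)) (0 + α.2.length)
    rw [prepend_snd_add, prepend_snd_of_lt _ _ (by omega)] at h0 h1
    exact absurd (h0.trans h1.symm) (by simp)
  have hx := prepend_mem_cone α fun _ => ⟨0, by omega⟩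
  refine eq_of_mem_cone hx ?_ (le_antisymm (key fun ψ => (h ψ).symm) (key h))
  rw [h]
  exact prepend_mem_cone _ _

/-! ### Topology of the cones -/

theorem isOpen_cone (α : FinPrefix n r) : IsOpen (cone α) := by
  have : cone α = (fun x : CantorSpace n r => (x.1, fun i : Fin α.2.length => x.2 i)) ⁻¹'
      {(α.1, fun i : Fin α.2.length => α.2[i])} := by
    ext x
    rw [mem_cone_iff, Set.mem_preimage, Set.mem_singleton_iff]
    simp only [pre, Prod.ext_iff, and_congr_right_iff]
    intro _
    rw [← List.ofFn_inj]
    simp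
  rw [this]
  exact (isOpen_discrete _).preimage (by fun_prop)

theorem cone_mem_nhds {α : FinPrefix n r} {x : CantorSpace n r} (h : x ∈ cone α) :
    cone α ∈ 𝓝 x :=
  (isOpen_cone α).mem_nhds h

theorem exists_cone_subset {x : CantorSpace n r} {U : Set (CantorSpace n r)} (hU : U ∈ 𝓝 x) :
    ∃ N, cone (pre N x) ⊆ U := by
  obtain ⟨A, hA, B, hB, hAB⟩ := mem_nhds_prod_iff.1 hU
  obtain ⟨_, ⟨y, N, rfl⟩, hx, hN⟩ :=
    (PiNat.isTopologicalBasis_cylinders fun _ => Fin n).mem_nhds_iff.1 hB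
  refine ⟨N, fun z hz => hAB ⟨?_, hN fun k hk => ?_⟩⟩
  · rw [mem_cone_pre_iff, pre_eq_iff] at hz
    rw [hz.1]
    exact mem_of_mem_nhds hA
  · rw [mem_cone_pre_iff, pre_eq_iff] at hz
    rw [hz.2 k hk]
    exact hx k hk

theorem continuous_prepend (α : FinPrefix n r) : Continuous (prepend α) := by
  refine continuous_const.prodMk (continuous_pi fun k => ?_)
  by_cases h : k < α.2.length
  · simpa [h] using continuous_const
  · simpa [h] using continuous_apply _

theorem continuous_tail (N : ℕ) : Continuous (tail (n := n) (r := r) N) := by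
  unfold tail
  fun_prop

theorem IsThompsonLike.continuous {f : CantorSpace n r → CantorSpace n r}
    (hf : IsThompsonLike f) : Continuous f := by
  refine continuous_iff_continuousAt.2 fun x => ?_
  obtain ⟨α, β, hx, h⟩ := hf x
  have : f =ᶠ[𝓝 x] fun y => prepend β (tail α.2.length y) := by
    filter_upwards [cone_mem_nhds hx] with y hy
    rw [← h, prepend_tail_of_mem hy]
  exact ContinuousAt.congr ((continuous_prepend β).comp (continuous_tail _)).continuousAt this.symm

/-- By compactness, an element of `V` is a prefix replacement on every sufficiently small cone. -/
theorem exists_uniform (f : V n r) :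
    ∃ N, ∃ b : FinPrefix n r → FinPrefix n r, ∀ α, N ≤ α.2.length →
      α.2.length ≤ (b α).2.length + N ∧ ∀ ψ, f.1 (prepend α ψ) = prepend (b α) ψ := by
  suffices ∃ N, ∀ α : FinPrefix n r, N ≤ α.2.length → ∃ β : FinPrefix n r,
      α.2.length ≤ β.2.length + N ∧ ∀ ψ, f.1 (prepend α ψ) = prepend β ψ by
    obtain ⟨N, hN⟩ := this
    choose! b hb using hN
    exact ⟨N, b, hb⟩
  choose α β hα hf using f.2
  obtain ⟨t, -, ht⟩ := isCompact_univ.elim_nhds_subcover (fun x => cone (α x))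
    fun x _ => cone_mem_nhds (hα x)
  refine ⟨t.sup fun x => (α x).2.length, fun γ hγ => ?_⟩
  rcases isEmpty_or_nonempty (Fin n) with hE | ⟨⟨a⟩⟩
  · exact ⟨γ, by omega, fun ψ => (hE.false (ψ 0)).elim⟩
  have hx : prepend γ (fun _ => a) ∈ ⋃ x ∈ t, cone (α x) := ht trivial
  simp only [Set.mem_iUnion] at hx
  obtain ⟨x, hxt, hx⟩ := hx
  have hle : (α x).2.length ≤ t.sup fun x => (α x).2.length :=
    Finset.le_sup (f := fun x => (α x).2.length) hxt
  obtain ⟨w, rfl⟩ := exists_eq_app hx (prepend_mem_cone γ _) (by omega)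
  refine ⟨app (β x) w, by simp; omega, fun ψ => ?_⟩
  rw [prepend_app, prepend_app]
  exact hf x _

/-! ### Transpositions of disjoint cones -/

theorem V.ext {f g : V n r} (h : ∀ x, f.1 x = g.1 x) : f = g :=
  Subtype.ext (Homeomorph.ext h)

theorem V.mul_apply (f g : V n r) (x : CantorSpace n r) : (f * g).1 x = f.1 (g.1 x) := rfl

theorem V.apply_inv_apply (f : V n r) (x : CantorSpace n r) : f.1 ((f⁻¹).1 x) = x :=
  f.1.apply_symm_apply x

open Classical in
/-- The map exchanging `αψ` and `βψ` and fixing the points outside the cones of `α` and `β`. -/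
noncomputable def swapFun (α β : FinPrefix n r) (x : CantorSpace n r) : CantorSpace n r :=
  if x ∈ cone α then prepend β (tail α.2.length x)
  else if x ∈ cone β then prepend α (tail β.2.length x) else x

theorem swapFun_left (α β : FinPrefix n r) (ψ : ℕ → Fin n) :
    swapFun α β (prepend α ψ) = prepend β ψ := by
  rw [swapFun, if_pos (prepend_mem_cone _ _), tail_prepend]

theorem swapFun_right {α β : FinPrefix n r} (h : Disjoint (cone α) (cone β)) (ψ : ℕ → Fin n) :
    swapFun α β (prepend β ψ) = prepend α ψ := by
  rw [swapFun, if_neg (Set.disjoint_right.1 h (prepend_mem_cone _ _)),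
    if_pos (prepend_mem_cone _ _), tail_prepend]

theorem swapFun_of_notMem {α β : FinPrefix n r} {x : CantorSpace n r} (hα : x ∉ cone α)
    (hβ : x ∉ cone β) : swapFun α β x = x := by
  rw [swapFun, if_neg hα, if_neg hβ]

theorem swapFun_involutive {α β : FinPrefix n r} (h : Disjoint (cone α) (cone β)) :
    Function.Involutive (swapFun α β) := fun x => by
  by_cases hα : x ∈ cone α
  · obtain ⟨ψ, rfl⟩ := hα
    rw [swapFun_left, swapFun_right h]
  by_cases hβ : x ∈ cone β
  · obtain ⟨ψ, rfl⟩ := hβ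
    rw [swapFun_right h, swapFun_left]
  rw [swapFun_of_notMem hα hβ, swapFun_of_notMem hα hβ]

theorem swapFun_isThompsonLike {α β : FinPrefix n r} (h : Disjoint (cone α) (cone β)) :
    IsThompsonLike (swapFun α β) := fun x => by
  by_cases hα : x ∈ cone α
  · exact ⟨α, β, hα, swapFun_left α β⟩
  by_cases hβ : x ∈ cone β
  · exact ⟨β, α, hβ, swapFun_right h⟩
  -- a prefix of `x` longer than `α` and `β` has a cone that meets neither of their cones
  refine ⟨pre (α.2.length + β.2.length) x, pre (α.2.length + β.2.length) x, mem_cone_pre _ x,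
    fun ψ => ?_⟩
  have hp := prepend_mem_cone (pre (α.2.length + β.2.length) x) ψ
  rw [mem_cone_pre_iff] at hp
  refine swapFun_of_notMem (fun h1 => hα ?_) fun h1 => hβ ?_
  · rw [mem_cone_iff] at h1 ⊢
    rw [← pre_eq_of_le (Nat.le_add_right _ _) hp, h1]
  · rw [mem_cone_iff] at h1 ⊢
    rw [← pre_eq_of_le (Nat.le_add_left _ _) hp, h1]

open Classical in
/-- The transposition in `V` of the cones of `α` and `β`; when these cones are not disjoint it is
the identity by convention. -/
noncomputable def swap (α β : FinPrefix n r) : V n r :=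
  if h : Disjoint (cone α) (cone β) then
    ⟨{ (swapFun_involutive h).toPerm with
        continuous_toFun := (swapFun_isThompsonLike h).continuous
        continuous_invFun := (swapFun_isThompsonLike h).continuous },
      swapFun_isThompsonLike h⟩
  else 1

theorem swap_apply {α β : FinPrefix n r} (h : Disjoint (cone α) (cone β))
    (x : CantorSpace n r) : (swap α β).1 x = swapFun α β x := by
  rw [swap, dif_pos h]
  rfl

theorem swap_left {α β : FinPrefix n r} (h : Disjoint (cone α) (cone β)) (ψ : ℕ → Fin n) :
    (swap α β).1 (prepend α ψ) = prepend β ψ := by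
  rw [swap_apply h, swapFun_left]

theorem swap_right {α β : FinPrefix n r} (h : Disjoint (cone α) (cone β)) (ψ : ℕ → Fin n) :
    (swap α β).1 (prepend β ψ) = prepend α ψ := by
  rw [swap_apply h, swapFun_right h]

theorem swap_of_notMem {α β : FinPrefix n r} {x : CantorSpace n r} (hα : x ∉ cone α)
    (hβ : x ∉ cone β) : (swap α β).1 x = x := by
  by_cases h : Disjoint (cone α) (cone β)
  · rw [swap_apply h, swapFun_of_notMem hα hβ]
  · rw [swap, dif_neg h]
    rfl

theorem swap_mul_self (α β : FinPrefix n r) : swap α β * swap α β = 1 := by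
  by_cases h : Disjoint (cone α) (cone β)
  · refine V.ext fun x => ?_
    rw [V.mul_apply, swap_apply h, swap_apply h, swapFun_involutive h]
    rfl
  · rw [swap, dif_neg h, mul_one]

theorem swap_comm {α β : FinPrefix n r} (h : Disjoint (cone α) (cone β)) :
    swap α β = swap β α := by
  refine V.ext fun x => ?_
  by_cases hα : x ∈ cone α
  · obtain ⟨ψ, rfl⟩ := hα
    rw [swap_left h, swap_right h.symm]
  by_cases hβ : x ∈ cone β
  · obtain ⟨ψ, rfl⟩ := hβ
    rw [swap_right h, swap_left h.symm]
  rw [swap_of_notMem hα hβ, swap_of_notMem hβ hα]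

theorem apply_mem_cone_iff {g : V n r} {α α' : FinPrefix n r}
    (hg : ∀ ψ, g.1 (prepend α ψ) = prepend α' ψ) {x : CantorSpace n r} :
    g.1 x ∈ cone α' ↔ x ∈ cone α := by
  constructor
  · rintro ⟨ψ, h⟩
    rw [← hg] at h
    exact ⟨ψ, g.1.injective h⟩
  · rintro ⟨ψ, rfl⟩
    rw [hg]
    exact prepend_mem_cone _ _

/-- Conjugating a transposition by an element which acts on both cones as a prefix replacement
gives the transposition of the image cones. -/
theorem conj_swap {g : V n r} {α β α' β' : FinPrefix n r} (h : Disjoint (cone α) (cone β))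
    (hα : ∀ ψ, g.1 (prepend α ψ) = prepend α' ψ) (hβ : ∀ ψ, g.1 (prepend β ψ) = prepend β' ψ) :
    g * swap α β * g⁻¹ = swap α' β' := by
  have h' : Disjoint (cone α') (cone β') := by
    refine Set.disjoint_left.2 fun x h1 h2 => ?_
    rw [← V.apply_inv_apply g x, apply_mem_cone_iff hα] at h1
    rw [← V.apply_inv_apply g x, apply_mem_cone_iff hβ] at h2
    exact Set.disjoint_left.1 h h1 h2
  rw [mul_inv_eq_iff_eq_mul]
  refine V.ext fun x => ?_
  rw [V.mul_apply, V.mul_apply]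
  by_cases hxα : x ∈ cone α
  · obtain ⟨ψ, rfl⟩ := hxα
    rw [swap_left h, hα, hβ, swap_left h']
  by_cases hxβ : x ∈ cone β
  · obtain ⟨ψ, rfl⟩ := hxβ
    rw [swap_right h, hα, hβ, swap_right h']
  rw [swap_of_notMem hxα hxβ, swap_of_notMem]
  · rwa [apply_mem_cone_iff hα]
  · rwa [apply_mem_cone_iff hβ]

theorem wapp_singleton_zero (ψ : ℕ → Fin n) : wapp [ψ 0] (fun k => ψ (k + 1)) = ψ := by
  funext k
  rcases k with _ | k <;> simp [wapp]

theorem exists_prepend_child (α : FinPrefix n r) (ψ : ℕ → Fin n) :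
    ∃ j φ, prepend α ψ = prepend (app α [j]) φ :=
  ⟨ψ 0, fun k => ψ (k + 1), by rw [prepend_app, wapp_singleton_zero]⟩

/-- The transposition of two cones is the product of the transpositions of their children. -/
theorem prod_swap_child {α β : FinPrefix n r} (h : Disjoint (cone α) (cone β)) :
    ((List.finRange n).map fun j => swap (app α [j]) (app β [j])).prod = swap α β := by
  have key : ∀ l : List (Fin n), l.Nodup → ∀ j ψ,
      ((l.map fun j => swap (app α [j]) (app β [j])).prod.1 (prepend (app α [j]) ψ) =
        if j ∈ l then prepend (app β [j]) ψ else prepend (app α [j]) ψ) ∧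
      ((l.map fun j => swap (app α [j]) (app β [j])).prod.1 (prepend (app β [j]) ψ) =
        if j ∈ l then prepend (app α [j]) ψ else prepend (app β [j]) ψ) := by
    intro l hl j ψ
    induction l with
    | nil => exact ⟨by simp, by simp⟩
    | cons i l ih =>
      rw [List.nodup_cons] at hl
      obtain ⟨ih1, ih2⟩ := ih hl.2
      simp only [List.map_cons, List.prod_cons, V.mul_apply, ih1, ih2, List.mem_cons]
      have hd : ∀ v w, Disjoint (cone (app α v)) (cone (app β w)) := disjoint_app h
      by_cases hj : j = i
      · subst hj
        simp [hl.1, swap_left (hd _ _), swap_right (hd _ _)]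
      · have hα := disjoint_child α hj
        have hβ := disjoint_child β hj
        have h1 : (swap (app α [i]) (app β [i])).1 (prepend (app α [j]) ψ) =
            prepend (app α [j]) ψ :=
          swap_of_notMem (Set.disjoint_left.1 hα (prepend_mem_cone _ _))
            (Set.disjoint_left.1 (hd _ _) (prepend_mem_cone _ _))
        have h2 : (swap (app α [i]) (app β [i])).1 (prepend (app β [j]) ψ) =
            prepend (app β [j]) ψ :=
          swap_of_notMem (Set.disjoint_right.1 (hd _ _) (prepend_mem_cone _ _))
            (Set.disjoint_left.1 hβ (prepend_mem_cone _ _))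
        by_cases hjl : j ∈ l <;> simp [hj, hjl, h1, h2]
  have key' : ∀ l : List (Fin n), ∀ x, x ∉ cone α → x ∉ cone β →
      (l.map fun j => swap (app α [j]) (app β [j])).prod.1 x = x := by
    intro l x hα hβ
    induction l with
    | nil => rfl
    | cons i l ih =>
      rw [List.map_cons, List.prod_cons, V.mul_apply, ih]
      exact swap_of_notMem (fun h => hα (cone_app_subset _ _ h))
        fun h => hβ (cone_app_subset _ _ h)
  refine V.ext fun x => ?_
  by_cases hxα : x ∈ cone α
  · obtain ⟨ψ, rfl⟩ := hxα
    rw [swap_left h]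
    rw [← wapp_singleton_zero ψ, ← prepend_app, ← prepend_app,
      (key _ (List.nodup_finRange n) _ _).1, if_pos (List.mem_finRange _)]
  by_cases hxβ : x ∈ cone β
  · obtain ⟨ψ, rfl⟩ := hxβ
    rw [swap_right h]
    rw [← wapp_singleton_zero ψ, ← prepend_app, ← prepend_app,
      (key _ (List.nodup_finRange n) _ _).2, if_pos (List.mem_finRange _)]
  rw [key' _ x hxα hxβ, swap_of_notMem hxα hxβ]

/-- The transpositions of disjoint cones contained in `Y`. -/
def swapsIn (Y : Set (CantorSpace n r)) : Set (V n r) :=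
  {f | ∃ α β, Disjoint (cone α) (cone β) ∧ cone α ⊆ Y ∧ cone β ⊆ Y ∧ f = swap α β}

theorem swap_mem_fixGroup {S : Set (CantorSpace n r)} {α β : FinPrefix n r}
    (hα : Disjoint (cone α) S) (hβ : Disjoint (cone β) S) : swap α β ∈ fixGroup S :=
  fun _ hx => swap_of_notMem (Set.disjoint_right.1 hα hx) (Set.disjoint_right.1 hβ hx)

theorem closure_swapsIn_le (Y : Set (CantorSpace n r)) :
    Subgroup.closure (swapsIn Y) ≤ fixGroup Yᶜ := by
  rw [Subgroup.closure_le]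
  rintro _ ⟨α, β, -, hα, hβ, rfl⟩
  exact swap_mem_fixGroup (Set.disjoint_compl_right_iff_subset.2 hα)
    (Set.disjoint_compl_right_iff_subset.2 hβ)

/-! ### Generation by transpositions -/

/-- A finite set of prefixes whose cones form a partition of `Y`. -/
structure IsPartition (P : Finset (FinPrefix n r)) (Y : Set (CantorSpace n r)) : Prop where
  subset : ∀ α ∈ P, cone α ⊆ Y
  exists_mem : ∀ x ∈ Y, ∃ α ∈ P, x ∈ cone α
  eq_of_mem : ∀ α ∈ P, ∀ β ∈ P, ∀ x, x ∈ cone α → x ∈ cone β → α = β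

/-- The map `f` is, on the cone of each prefix `α ∈ P`, the prefix replacement `αψ ↦ b(α)ψ`. -/
def IsTable (f : V n r) (P : Finset (FinPrefix n r)) (b : FinPrefix n r → FinPrefix n r) : Prop :=
  ∀ α ∈ P, ∀ ψ, f.1 (prepend α ψ) = prepend (b α) ψ

theorem IsPartition.disjoint {P : Finset (FinPrefix n r)} {Y : Set (CantorSpace n r)}
    (hP : IsPartition P Y) {α β : FinPrefix n r} (hα : α ∈ P) (hβ : β ∈ P) (h : α ≠ β) :
    Disjoint (cone α) (cone β) :=
  Set.disjoint_left.2 fun x h1 h2 => h (hP.eq_of_mem α hα β hβ x h1 h2)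

theorem apply_mem_of_mem_fixGroup_compl {Y : Set (CantorSpace n r)} {f : V n r}
    (hf : f ∈ fixGroup Yᶜ) {x : CantorSpace n r} (hx : x ∈ Y) : f.1 x ∈ Y := by
  by_contra h
  have h1 := f.1.injective (hf _ h)
  rw [h1] at h
  exact h hx

theorem IsTable.injOn (hn : 2 ≤ n) {P : Finset (FinPrefix n r)} {Y : Set (CantorSpace n r)}
    (hP : IsPartition P Y) {f : V n r} {b : FinPrefix n r → FinPrefix n r} (hb : IsTable f P b) :
    Set.InjOn b P := by
  intro α hα β hβ h
  obtain ⟨_, ψ, rfl⟩ := cone_nonempty hn α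
  have h1 : prepend α ψ = prepend β ψ := by
    apply f.1.injective
    rw [hb α hα, hb β hβ, h]
  exact hP.eq_of_mem α hα β hβ _ (prepend_mem_cone α ψ)
    (h1 ▸ prepend_mem_cone β ψ)

theorem IsTable.isPartition_image {P : Finset (FinPrefix n r)} {Y : Set (CantorSpace n r)}
    (hP : IsPartition P Y) {f : V n r} {b : FinPrefix n r → FinPrefix n r} (hb : IsTable f P b)
    (hf : f ∈ fixGroup Yᶜ) : IsPartition (P.image b) Y where
  subset := by
    simp only [Finset.forall_mem_image]
    rintro α hα _ ⟨ψ, rfl⟩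
    rw [← hb α hα]
    exact apply_mem_of_mem_fixGroup_compl hf (hP.subset α hα (prepend_mem_cone _ _))
  exists_mem x hx := by
    obtain ⟨α, hα, h⟩ :=
      hP.exists_mem _ (apply_mem_of_mem_fixGroup_compl ((fixGroup Yᶜ).inv_mem hf) hx)
    refine ⟨b α, Finset.mem_image_of_mem b hα, ?_⟩
    rwa [← apply_mem_cone_iff (hb α hα), V.apply_inv_apply] at h
  eq_of_mem := by
    simp only [Finset.forall_mem_image]
    intro α hα β hβ x h1 h2
    rw [← V.apply_inv_apply f x] at h1 h2
    rw [apply_mem_cone_iff (hb α hα)] at h1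
    rw [apply_mem_cone_iff (hb β hβ)] at h2
    rw [hP.eq_of_mem α hα β hβ _ h1 h2]

/-- After multiplication by transpositions, the images of some of the cones of a table can be
prescribed among the cones of the range partition. -/
theorem exists_rearrangement (hn : 2 ≤ n) {P Q : Finset (FinPrefix n r)}
    {Y : Set (CantorSpace n r)}
    (hP : IsPartition P Y) (hQ : IsPartition Q Y) {f : V n r} {b b' : FinPrefix n r → FinPrefix n r}
    (hb : IsTable f P b) (hbQ : ∀ α ∈ P, b α ∈ Q) (A : Finset (FinPrefix n r)) :
    A ⊆ P → (∀ α ∈ A, b' α ∈ Q) → Set.InjOn b' A →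
      ∃ t ∈ Subgroup.closure (swapsIn Y), ∃ c, IsTable (t * f) P c ∧ (∀ α ∈ P, c α ∈ Q) ∧
        ∀ α ∈ A, c α = b' α := by
  induction A using Finset.induction_on with
  | empty => exact fun _ _ _ => ⟨1, one_mem _, b, by rwa [one_mul], hbQ, by simp⟩
  | insert α A hαA ih =>
    intro hA hb' hinj
    obtain ⟨t, ht, c, hc, hcQ, hcA⟩ := ih (fun β hβ => hA (Finset.mem_insert_of_mem hβ))
      (fun β hβ => hb' β (Finset.mem_insert_of_mem hβ))
      (hinj.mono (by simp))
    have hαP : α ∈ P := hA (Finset.mem_insert_self _ _)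
    have hαQ : b' α ∈ Q := hb' α (Finset.mem_insert_self _ _)
    by_cases hα : c α = b' α
    · refine ⟨t, ht, c, hc, hcQ, fun β hβ => ?_⟩
      rcases Finset.mem_insert.1 hβ with rfl | hβ
      exacts [hα, hcA β hβ]
    have hd := hQ.disjoint (hcQ α hαP) hαQ hα
    refine ⟨swap (c α) (b' α) * t, mul_mem (Subgroup.subset_closure
      ⟨_, _, hd, hQ.subset _ (hcQ α hαP), hQ.subset _ hαQ, rfl⟩) ht,
      fun β => Equiv.swap (c α) (b' α) (c β), fun β hβ ψ => ?_, fun β hβ => ?_, fun β hβ => ?_⟩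
    · rw [mul_assoc, V.mul_apply, hc β hβ]
      change _ = prepend (Equiv.swap (c α) (b' α) (c β)) ψ
      by_cases h1 : c β = c α
      · rw [h1, Equiv.swap_apply_left, swap_left hd]
      by_cases h2 : c β = b' α
      · rw [h2, Equiv.swap_apply_right, swap_right hd]
      rw [Equiv.swap_apply_of_ne_of_ne h1 h2]
      exact swap_of_notMem
        (Set.disjoint_left.1 (hQ.disjoint (hcQ β hβ) (hcQ α hαP) h1) (prepend_mem_cone _ _))
        (Set.disjoint_left.1 (hQ.disjoint (hcQ β hβ) hαQ h2) (prepend_mem_cone _ _))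
    · change Equiv.swap (c α) (b' α) (c β) ∈ Q
      by_cases h1 : c β = c α
      · rwa [h1, Equiv.swap_apply_left]
      by_cases h2 : c β = b' α
      · rw [h2, Equiv.swap_apply_right]
        exact hcQ α hαP
      rw [Equiv.swap_apply_of_ne_of_ne h1 h2]
      exact hcQ β hβ
    · rcases Finset.mem_insert.1 hβ with rfl | hβA
      · exact Equiv.swap_apply_left _ _
      have hne : β ≠ α := fun h => hαA (h ▸ hβA)
      have h2 : c β ≠ b' α := fun h => hne (hinj hβ (Finset.mem_insert_self _ _) (by
        rw [← hcA β hβA, h]))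
      have h1 : c β ≠ c α := fun h => hne (hc.injOn hn hP (hA hβ) hαP h)
      change Equiv.swap (c α) (b' α) (c β) = b' β
      rw [Equiv.swap_apply_of_ne_of_ne h1 h2, hcA β hβA]

/-- A partition with a cone of depth greater than `L` contains all the children of some prefix of
length at least `L`, namely the parent of a longest prefix. -/
theorem IsPartition.exists_caret {P : Finset (FinPrefix n r)} {Y : Set (CantorSpace n r)}
    (hP : IsPartition P Y) {L : ℕ} (hY : ∀ x y, pre L x = pre L y → x ∈ Y → y ∈ Y)
    (h : ∃ α ∈ P, L < α.2.length) :
    ∃ γ : FinPrefix n r, L ≤ γ.2.length ∧ ∀ j, app γ [j] ∈ P := by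
  obtain ⟨α, hα, hL⟩ := h
  obtain ⟨β, hβ, hmax⟩ := P.exists_max_image (fun α => α.2.length) ⟨α, hα⟩
  have hβL : L < β.2.length := hL.trans_le (hmax α hα)
  obtain ⟨γ, i, rfl⟩ : ∃ γ i, β = app γ [i] := by
    have hne : β.2 ≠ [] := by
      rintro h
      simp [h] at hβL
    exact ⟨(β.1, β.2.dropLast), β.2.getLast hne,
      Prod.ext rfl (List.dropLast_append_getLast hne).symm⟩
  have hγL : L ≤ γ.2.length := by
    simp at hβL
    omega
  refine ⟨γ, hγL, fun j => ?_⟩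
  have hx := prepend_mem_cone (app γ [j]) fun _ => i
  have hxγ := cone_app_subset _ _ hx
  have hy := prepend_mem_cone (app γ [i]) fun _ => i
  have hyγ := cone_app_subset _ _ hy
  have hxY : prepend (app γ [j]) (fun _ => i) ∈ Y := by
    refine hY _ _ (pre_eq_of_le hγL ?_) (hP.subset _ hβ hy)
    rw [mem_cone_iff] at hxγ hyγ
    rw [hxγ, hyγ]
  obtain ⟨δ, hδ, hxδ⟩ := hP.exists_mem _ hxY
  have hδl := hmax δ hδ
  simp only [app_length, List.length_singleton] at hδl
  rcases Nat.lt_or_ge γ.2.length δ.2.length with hlt | hge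
  · rwa [eq_of_mem_cone hx hxδ (by simp; omega)]
  · obtain ⟨w, rfl⟩ := exists_eq_app hxδ hxγ hge
    have h1 := hP.eq_of_mem δ hδ _ hβ _ (cone_app_subset _ _ hyγ) hy
    have h2 := congrArg (fun α : FinPrefix n r => α.2.length) h1
    simp at h2
    omega

/-- Among the partitions of `Y` into cones of depth at least `L`, the one into cones of depth `L` is
distinguished by its cardinality. -/
theorem IsPartition.exists_long (hn : 2 ≤ n) {P Q : Finset (FinPrefix n r)}
    {Y : Set (CantorSpace n r)} (hP : IsPartition P Y) (hQ : IsPartition Q Y) {L : ℕ}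
    (hY : ∀ x y, pre L x = pre L y → x ∈ Y → y ∈ Y)
    (hPL : ∀ α ∈ P, L ≤ α.2.length) (hQL : ∀ α ∈ Q, L ≤ α.2.length) (hcard : P.card = Q.card)
    (h : ∃ α ∈ P, L < α.2.length) : ∃ α ∈ Q, L < α.2.length := by
  by_contra! hQ'
  obtain ⟨γ, hγL, hγ⟩ := hP.exists_caret hY h
  -- truncation to length `L` maps `P` onto `Q`, and it identifies the children of `γ`
  have hsub : Q ⊆ P.image fun α => (α.1, α.2.take L) := by
    intro β hβ
    have hβL : β.2.length = L := le_antisymm (hQ' β hβ) (hQL β hβ)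
    obtain ⟨x, hx⟩ := cone_nonempty hn β
    obtain ⟨α, hα, ψ, rfl⟩ := hP.exists_mem x (hQ.subset β hβ hx)
    refine Finset.mem_image.2 ⟨α, hα, ?_⟩
    rw [← pre_prepend_of_le (hPL α hα) ψ, ← hβL]
    exact mem_cone_iff.1 hx
  have hinj := Finset.card_image_iff.1
    (le_antisymm Finset.card_image_le (hcard.trans_le (Finset.card_le_card hsub)))
  have h01 := hinj (hγ ⟨0, by omega⟩) (hγ ⟨1, by omega⟩) 
    (by simp [app, List.take_append_of_le_length hγL])
  simpa using app_injective γ h01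

theorem IsPartition.eq_of_length_eq (hn : 2 ≤ n) {P Q : Finset (FinPrefix n r)}
    {Y : Set (CantorSpace n r)} (hP : IsPartition P Y) (hQ : IsPartition Q Y) {L : ℕ}
    (hPL : ∀ α ∈ P, α.2.length = L) (hQL : ∀ α ∈ Q, α.2.length = L) : P = Q := by
  have key : ∀ {P Q : Finset (FinPrefix n r)}, IsPartition P Y → IsPartition Q Y →
      (∀ α ∈ P, α.2.length = L) → (∀ α ∈ Q, α.2.length = L) → P ⊆ Q := by
    intro P Q hP hQ hPL hQL α hα
    obtain ⟨x, hx⟩ := cone_nonempty hn α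
    obtain ⟨β, hβ, hxβ⟩ := hQ.exists_mem x (hP.subset α hα hx)
    rwa [eq_of_mem_cone hx hxβ (by rw [hPL α hα, hQL β hβ])]
  exact Finset.Subset.antisymm (key hP hQ hPL hQL) (key hQ hP hQL hPL)

/-- Replacing the children of `γ` by `γ` in a partition. -/
def collapse (P : Finset (FinPrefix n r)) (γ : FinPrefix n r) :
    Finset (FinPrefix n r) :=
  insert γ (P \ Finset.univ.image fun j => app γ [j])

theorem mem_collapse {P : Finset (FinPrefix n r)} {γ α : FinPrefix n r} :
    α ∈ collapse P γ ↔ α = γ ∨ α ∈ P ∧ ∀ j, app γ [j] ≠ α := by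
  simp [collapse]

theorem card_collapse_lt (hn : 2 ≤ n) {P : Finset (FinPrefix n r)} {γ : FinPrefix n r}
    (hγ : ∀ j, app γ [j] ∈ P) : (collapse P γ).card < P.card := by
  have h1 : (Finset.univ.image fun j : Fin n => app γ [j]) ⊆ P := by
    simp only [Finset.image_subset_iff]
    exact fun j _ => hγ j
  have h2 : (Finset.univ.image fun j : Fin n => app γ [j]).card = n := by
    rw [Finset.card_image_of_injective _ fun j k h => by simpa using app_injective γ h]
    simp
  have h3 := Finset.card_sdiff_add_card_eq_card h1
  have h4 := Finset.card_insert_le γ (P \ Finset.univ.image fun j : Fin n => app γ [j])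
  exact h4.trans_lt (by omega)

theorem IsPartition.collapse {P : Finset (FinPrefix n r)} {Y : Set (CantorSpace n r)}
    (hP : IsPartition P Y) {γ : FinPrefix n r} (hγ : ∀ j, app γ [j] ∈ P) :
    IsPartition (collapse P γ) Y := by
  have key : ∀ α ∈ P, (∀ j, app γ [j] ≠ α) → ∀ x ∈ cone γ, x ∉ cone α := by
    rintro α hα hne _ ⟨ψ, rfl⟩ hx
    obtain ⟨j, φ, h⟩ := exists_prepend_child γ ψ
    rw [h] at hx
    exact hne j (hP.eq_of_mem _ (hγ j) _ hα _ (prepend_mem_cone _ _) hx)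
  refine ⟨fun α hα => ?_, fun x hx => ?_, fun α hα β hβ x hxα hxβ => ?_⟩
  · rcases mem_collapse.1 hα with rfl | ⟨hα, -⟩
    · rintro _ ⟨ψ, rfl⟩
      obtain ⟨j, φ, h⟩ := exists_prepend_child α ψ
      rw [h]
      exact hP.subset _ (hγ j) (prepend_mem_cone _ _)
    · exact hP.subset α hα
  · obtain ⟨α, hα, hxα⟩ := hP.exists_mem x hx
    by_cases h : ∃ j, app γ [j] = α
    · obtain ⟨j, rfl⟩ := h
      exact ⟨γ, mem_collapse.2 (Or.inl rfl), cone_app_subset _ _ hxα⟩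
    · exact ⟨α, mem_collapse.2 (Or.inr ⟨hα, not_exists.1 h⟩), hxα⟩
  · rcases mem_collapse.1 hα with hαγ | ⟨hα, hα'⟩ <;>
      rcases mem_collapse.1 hβ with hβγ | ⟨hβ, hβ'⟩
    · rw [hαγ, hβγ]
    · exact (key β hβ hβ' x (hαγ ▸ hxα) hxβ).elim
    · exact (key α hα hα' x (hβγ ▸ hxβ) hxα).elim
    · exact hP.eq_of_mem α hα β hβ x hxα hxβ

/-- An element with a table is a product of transpositions. If the domain partition contains all
children of a prefix `γ` then, by counting, the range partition contains all children of some
prefix `δ`; transpositions of cones of the range partition bring the former children to the latter,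
and the table becomes smaller. If there is no such `γ` then both partitions consist of the cones
of depth `L` in `Y`. -/
theorem IsTable.mem_closure_swapsIn (hn : 2 ≤ n) {Y : Set (CantorSpace n r)} {L : ℕ}
    (hY : ∀ x y, pre L x = pre L y → x ∈ Y → y ∈ Y) {P : Finset (FinPrefix n r)} {f : V n r}
    {b : FinPrefix n r → FinPrefix n r} (hP : IsPartition P Y) (hb : IsTable f P b)
    (hf : f ∈ fixGroup Yᶜ) (hPL : ∀ α ∈ P, L ≤ α.2.length) (hbL : ∀ α ∈ P, L ≤ (b α).2.length) :
    f ∈ Subgroup.closure (swapsIn Y) := by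
  induction hm : P.card using Nat.strong_induction_on generalizing P f b with
  | _ m ih =>
  have hQ := hb.isPartition_image hP hf
  have hbQ : ∀ α ∈ P, b α ∈ P.image b := fun α hα => Finset.mem_image_of_mem b hα
  have hQL : ∀ α ∈ P.image b, L ≤ α.2.length := by
    simpa only [Finset.forall_mem_image] using hbL
  have hcard : P.card = (P.image b).card :=
    (Finset.card_image_of_injOn (hb.injOn hn hP)).symm
  by_cases hlong : ∃ α ∈ P, L < α.2.length
  · obtain ⟨γ, hγL, hγ⟩ := hP.exists_caret hY hlong
    obtain ⟨δ, hδL, hδ⟩ := hQ.exists_caret hY (hP.exists_long hn hQ hY hPL hQL hcard hlong)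
    obtain ⟨t, ht, c, hc, hcQ, hcγ⟩ := exists_rearrangement hn hP hQ hb hbQ
      (b' := fun α => app δ (α.2.drop γ.2.length)) (Finset.univ.image fun j => app γ [j])
      (by simpa [Finset.image_subset_iff] using hγ)
      (by simpa [app] using hδ)
      (by
        intro α hα β hβ h
        simp only [Finset.coe_image, Finset.coe_univ, Set.image_univ, Set.mem_range] at hα hβ
        obtain ⟨j, rfl⟩ := hα
        obtain ⟨k, rfl⟩ := hβ
        have := app_injective δ h
        simp [app] at this
        rw [this])
    have hcγ' : ∀ j, c (app γ [j]) = app δ [j] := fun j => by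
      rw [hcγ _ (by simp)]
      simp [app]
    have htf : t * f ∈ Subgroup.closure (swapsIn Y) := by
      refine ih _ (hm ▸ card_collapse_lt hn hγ) (b := Function.update c γ δ) (hP.collapse hγ)
        ?_ (mul_mem (closure_swapsIn_le Y ht) hf) ?_ ?_ rfl
      · have hγδ : ∀ ψ, (t * f).1 (prepend γ ψ) = prepend δ ψ := by
          intro ψ
          rw [← wapp_singleton_zero ψ, ← prepend_app, hc _ (hγ _), hcγ', prepend_app]
        intro α hα ψ
        by_cases h : α = γ
        · subst h
          rw [Function.update_self, hγδ]
        · rw [Function.update_of_ne h]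
          exact hc α ((mem_collapse.1 hα).resolve_left h).1 ψ
      · intro α hα
        rcases mem_collapse.1 hα with rfl | ⟨hα, -⟩
        exacts [hγL, hPL α hα]
      · intro α hα
        by_cases h : α = γ
        · subst h
          rwa [Function.update_self]
        · rw [Function.update_of_ne h]
          exact hQL _ (hcQ α ((mem_collapse.1 hα).resolve_left h).1)
    exact (Subgroup.mul_mem_cancel_left _ ht).1 htf
  · have hlong' : ¬∃ α ∈ P.image b, L < α.2.length := fun h =>
      hlong (hQ.exists_long hn hP hY hQL hPL hcard.symm h)
    push Not at hlong hlong'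
    have hPQ : P = P.image b := hP.eq_of_length_eq hn hQ
      (fun α hα => le_antisymm (hlong α hα) (hPL α hα))
      (fun α hα => le_antisymm (hlong' α hα) (hQL α hα))
    obtain ⟨t, ht, c, hc, -, hcP⟩ := exists_rearrangement hn hP hQ hb hbQ (b' := id) P
      subset_rfl (fun α hα => hPQ ▸ hα) Function.injective_id.injOn
    have h1 : t * f = 1 := by
      refine V.ext fun x => ?_
      by_cases hx : x ∈ Y
      · obtain ⟨α, hα, ψ, rfl⟩ := hP.exists_mem x hx
        rw [hc α hα, hcP α hα]
        rfl
      · exact mul_mem (closure_swapsIn_le Y ht) hf x hx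
    rw [← inv_eq_of_mul_eq_one_right h1]
    exact inv_mem ht

theorem finite_length_eq (N : ℕ) : {α : FinPrefix n r | α.2.length = N}.Finite :=
  (Set.finite_univ.prod (List.finite_length_eq (Fin n) N)).subset fun _ h => ⟨trivial, h⟩

/-- The prefixes of length `N`. -/
noncomputable def words (n r N : ℕ) : Finset (FinPrefix n r) :=
  (finite_length_eq N).toFinset

@[simp] theorem mem_words {N : ℕ} {α : FinPrefix n r} : α ∈ words n r N ↔ α.2.length = N := by
  simp [words]

theorem mem_closure_swapsIn (hn : 2 ≤ n) {Y : Set (CantorSpace n r)} {L : ℕ}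
    (hY : ∀ x y, pre L x = pre L y → x ∈ Y → y ∈ Y) {f : V n r} (hf : f ∈ fixGroup Yᶜ) :
    f ∈ Subgroup.closure (swapsIn Y) := by
  classical
  obtain ⟨N, b, hb⟩ := exists_uniform f
  refine IsTable.mem_closure_swapsIn hn hY (P := {α ∈ words n r (N + L) | cone α ⊆ Y}) (b := b)
    ⟨?_, fun x hx => ⟨pre (N + L) x, ?_, mem_cone_pre _ _⟩, ?_⟩ ?_ hf ?_ ?_
  · simp
  · simp only [Finset.mem_filter, mem_words, pre_length, true_and]
    intro y hy
    rw [mem_cone_pre_iff] at hy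
    exact hY x y (pre_eq_of_le (by omega) hy.symm) hx
  · simp only [Finset.mem_filter, mem_words, and_imp]
    intro α hα _ β hβ _ x h1 h2
    exact eq_of_mem_cone h1 h2 (by omega)
  · simp only [IsTable, Finset.mem_filter, mem_words, and_imp]
    exact fun α hα _ => (hb α (by omega)).2
  · simp only [Finset.mem_filter, mem_words, and_imp]
    intro α hα _
    omega
  · simp only [Finset.mem_filter, mem_words, and_imp]
    intro α hα _
    have := (hb α (by omega)).1
    omega

/-- An element of `V` that is the identity near each point of a finite set `S` is a product of
transpositions of cones disjoint from `S`. -/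
theorem mem_closure_swapsIn_compl (hn : 2 ≤ n) {S : Set (CantorSpace n r)} (hS : S.Finite)
    {f : V n r} (hf : ∀ p ∈ S, ∀ᶠ x in 𝓝 p, f.1 x = x) :
    f ∈ Subgroup.closure (swapsIn Sᶜ) := by
  have h1 : ∀ p ∈ S, ∃ N, ∀ x ∈ cone (pre N p), f.1 x = x := fun p hp =>
    exists_cone_subset (hf p hp)
  choose! N hN using h1
  obtain ⟨L, hL⟩ := (hS.image N).bddAbove
  have hL' : ∀ p ∈ S, N p ≤ L := fun p hp => hL (Set.mem_image_of_mem N hp)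
  have h2 : f ∈ Subgroup.closure (swapsIn {x | ∀ p ∈ S, pre L x ≠ pre L p}) := by
    refine mem_closure_swapsIn hn (L := L) (fun x y hxy hx p hp => hxy ▸ hx p hp) fun x hx => ?_
    simp only [Set.mem_compl_iff, Set.mem_ofPred_eq, not_forall, not_not] at hx
    obtain ⟨p, hp, hx⟩ := hx
    exact hN p hp x (mem_cone_pre_iff.2 (pre_eq_of_le (hL' p hp) hx))
  refine Subgroup.closure_mono ?_ h2
  have hsub : {x | ∀ p ∈ S, pre L x ≠ pre L p} ⊆ Sᶜ := fun x hx hxS => hx x hxS rfl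
  rintro _ ⟨α, β, hd, hα, hβ, rfl⟩
  exact ⟨α, β, hd, hα.trans hsub, hβ.trans hsub, rfl⟩

/-! ### Classes of transpositions in abelian quotients -/

open Classical in
/-- The transposition of two cones as an element of `Fix(S)`; it is the identity by convention when
the transposition does not fix `S`. -/
noncomputable def fixSwap (S : Set (CantorSpace n r)) (α β : FinPrefix n r) : fixGroup S :=
  if h : swap α β ∈ fixGroup S then ⟨swap α β, h⟩ else 1

/-- The cones of `α` and `β` are disjoint from each other and from `S`. -/
structure Apart (S : Set (CantorSpace n r)) (α β : FinPrefix n r) : Prop where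
  disj : Disjoint (cone α) (cone β)
  left : Disjoint (cone α) S
  right : Disjoint (cone β) S

theorem Apart.symm {S : Set (CantorSpace n r)} {α β : FinPrefix n r} (h : Apart S α β) :
    Apart S β α := ⟨h.disj.symm, h.right, h.left⟩

theorem Apart.app {S : Set (CantorSpace n r)} {α β : FinPrefix n r} (h : Apart S α β)
    (v w : List (Fin n)) : Apart S (app α v) (app β w) :=
  ⟨disjoint_app h.disj v w, h.left.mono_left (cone_app_subset _ _),
    h.right.mono_left (cone_app_subset _ _)⟩

theorem Apart.children {S : Set (CantorSpace n r)} {α : FinPrefix n r} (h : Disjoint (cone α) S)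
    {j k : Fin n} (hjk : j ≠ k) : Apart S (HigmanThompson.app α [j]) (HigmanThompson.app α [k]) :=
  ⟨disjoint_child α hjk, h.mono_left (cone_app_subset _ _), h.mono_left (cone_app_subset _ _)⟩

theorem coe_fixSwap {S : Set (CantorSpace n r)} {α β : FinPrefix n r} (h : Apart S α β) :
    (fixSwap S α β : V n r) = swap α β := by
  rw [fixSwap, dif_pos (swap_mem_fixGroup h.left h.right)]

theorem pow_eq_one_of_even {M : Type*} [Monoid M] {x : M} (hx : x * x = 1) {m : ℕ}
    (hm : Even m) : x ^ m = 1 := by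
  obtain ⟨k, rfl⟩ := hm
  rw [← two_mul, pow_mul, pow_two, hx, one_pow]

theorem pow_eq_self_of_odd {M : Type*} [Monoid M] {x : M} (hx : x * x = 1) {m : ℕ}
    (hm : Odd m) : x ^ m = x := by
  obtain ⟨k, rfl⟩ := hm
  rw [pow_succ, pow_mul, pow_two, hx, one_pow, one_mul]

section Classes

variable {S : Set (CantorSpace n r)} {B : Type*} [CommGroup B] (φ : fixGroup S →* B)
  {α β γ δ : FinPrefix n r}

theorem map_fixSwap_comm (h : Apart S α β) : φ (fixSwap S α β) = φ (fixSwap S β α) := by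
  congr 1
  refine Subtype.ext ?_
  rw [coe_fixSwap h, coe_fixSwap h.symm, swap_comm h.disj]

theorem map_fixSwap_mul_self (h : Apart S α β) :
    φ (fixSwap S α β) * φ (fixSwap S α β) = 1 := by
  rw [← map_mul, ← map_one φ]
  congr 1
  refine Subtype.ext ?_
  rw [Subgroup.coe_mul, coe_fixSwap h, swap_mul_self]
  rfl

/-- Two transpositions among three disjoint cones are conjugate by the third one. -/
theorem map_fixSwap_eq_of_apart (h1 : Apart S α β) (h2 : Apart S α γ) (h3 : Apart S β γ) :
    φ (fixSwap S α β) = φ (fixSwap S α γ) := by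
  have h : fixSwap S β γ * fixSwap S α β * (fixSwap S β γ)⁻¹ = fixSwap S α γ := by
    refine Subtype.ext ?_
    rw [Subgroup.coe_mul, Subgroup.coe_mul, Subgroup.coe_inv, coe_fixSwap h1, coe_fixSwap h2,
      coe_fixSwap h3]
    refine conj_swap h1.disj (fun ψ => ?_) (swap_left h3.disj)
    exact swap_of_notMem (Set.disjoint_left.1 h1.disj (prepend_mem_cone _ _))
      (Set.disjoint_left.1 h2.disj (prepend_mem_cone _ _))
  rw [← h, map_mul, map_mul, map_inv, mul_inv_cancel_comm]

theorem map_fixSwap_children (h : Apart S α β) (j k j' k' : Fin n) :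
    φ (fixSwap S (app α [j]) (app β [k])) = φ (fixSwap S (app α [j']) (app β [k'])) := by
  have key : ∀ {α β : FinPrefix n r}, Apart S α β → ∀ j k k' : Fin n,
      φ (fixSwap S (app α [j]) (app β [k])) = φ (fixSwap S (app α [j]) (app β [k'])) := by
    intro α β h j k k'
    by_cases hk : k = k'
    · rw [hk]
    · exact map_fixSwap_eq_of_apart φ (h.app _ _) (h.app _ _) (Apart.children h.right hk)
  rw [key h j k k', map_fixSwap_comm φ (h.app _ _), key h.symm k' j j',
    map_fixSwap_comm φ (h.symm.app _ _)]

/-- A transposition is the product of the `n` transpositions of children, which all have the same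
class. -/
theorem map_fixSwap_eq_pow (h : Apart S α β) (j k : Fin n) :
    φ (fixSwap S α β) = φ (fixSwap S (app α [j]) (app β [k])) ^ n := by
  have h1 : ((List.finRange n).map fun j => fixSwap S (app α [j]) (app β [j])).prod =
      fixSwap S α β := by
    refine Subtype.ext ?_
    rw [coe_fixSwap h, ← prod_swap_child h.disj, ← Subgroup.coe_subtype, map_list_prod,
      List.map_map]
    congr 1
    exact List.map_congr_left fun j _ => coe_fixSwap (h.app _ _)
  rw [← h1, map_list_prod, List.map_map, List.prod_eq_pow_card _
    (φ (fixSwap S (app α [j]) (app β [k])))]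
  · simp
  · simp only [List.mem_map, List.mem_finRange, true_and, Function.comp_apply]
    rintro _ ⟨i, rfl⟩
    exact map_fixSwap_children φ h i i j k

theorem map_fixSwap_of_even (hn : 2 ≤ n) (hev : Even n) (h : Apart S α β) :
    φ (fixSwap S α β) = 1 := by
  rw [map_fixSwap_eq_pow φ h ⟨0, by omega⟩ ⟨0, by omega⟩]
  exact pow_eq_one_of_even (map_fixSwap_mul_self φ (h.app _ _)) hev

theorem map_fixSwap_child_of_odd (hodd : Odd n) (h : Apart S α β) (j k : Fin n) :
    φ (fixSwap S (app α [j]) (app β [k])) = φ (fixSwap S α β) := by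
  rw [map_fixSwap_eq_pow φ h j k]
  exact (pow_eq_self_of_odd (map_fixSwap_mul_self φ (h.app _ _)) hodd).symm

theorem map_fixSwap_left_child_of_odd (hn : 2 ≤ n) (hodd : Odd n) (h : Apart S α β) (j : Fin n) :
    φ (fixSwap S (app α [j]) β) = φ (fixSwap S α β) := by
  have : Nontrivial (Fin n) := Fin.nontrivial_iff_two_le.2 hn
  obtain ⟨i, hi⟩ := exists_ne j
  have h1 : ∀ i, Apart S (app α [i]) β := fun i => by simpa using h.app [i] []
  rw [map_fixSwap_eq_of_apart φ (h1 j) (Apart.children h.left hi.symm) (h1 i).symm,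
    map_fixSwap_eq_of_apart φ (Apart.children h.left hi.symm) (h.app [j] [j]) (h.app [i] [j]),
    map_fixSwap_child_of_odd φ hodd h]

theorem map_fixSwap_left_app_of_odd (hn : 2 ≤ n) (hodd : Odd n) (h : Apart S α β)
    (w : List (Fin n)) : φ (fixSwap S (app α w) β) = φ (fixSwap S α β) := by
  induction w using List.reverseRecOn with
  | nil => rw [app_nil]
  | append_singleton w j ih =>
    have h1 : Apart S (app α w) β := by simpa using h.app w []
    rw [← app_app, map_fixSwap_left_child_of_odd φ hn hodd h1, ih]

theorem map_fixSwap_app_of_odd (hn : 2 ≤ n) (hodd : Odd n) (h : Apart S α β)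
    (v w : List (Fin n)) : φ (fixSwap S (app α v) (app β w)) = φ (fixSwap S α β) := by
  have h1 : Apart S α (app β w) := by simpa using h.app [] w
  rw [map_fixSwap_left_app_of_odd φ hn hodd h1, map_fixSwap_comm φ h1,
    map_fixSwap_left_app_of_odd φ hn hodd h.symm, map_fixSwap_comm φ h.symm]

/-- For odd `n` all transpositions have the same class in every abelian quotient: cutting down the
cones one may assume that all prefixes have the same length, so that different ones have disjoint
cones. -/
theorem map_fixSwap_eq_of_odd (hn : 2 ≤ n) (hodd : Odd n) (h : Apart S α β) (h' : Apart S γ δ) :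
    φ (fixSwap S α β) = φ (fixSwap S γ δ) := by
  have key : ∀ {N : ℕ} {α β γ δ : FinPrefix n r}, α.2.length = N → β.2.length = N →
      γ.2.length = N → δ.2.length = N → Apart S α β → Apart S γ δ →
      φ (fixSwap S α β) = φ (fixSwap S γ δ) := by
    intro N α β γ δ hα hβ hγ hδ h h'
    have step : ∀ {α β δ : FinPrefix n r}, β.2.length = N → δ.2.length = N → Apart S α β →
        Apart S α δ → φ (fixSwap S α β) = φ (fixSwap S α δ) := by
      intro α β δ hβ hδ h h'
      by_cases hβδ : β = δ
      · rw [hβδ]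
      · exact map_fixSwap_eq_of_apart φ h h'
          ⟨disjoint_of_length_eq (hβ.trans hδ.symm) hβδ, h.right, h'.right⟩
    by_cases hαγ : α = γ
    · subst hαγ
      exact step hβ hδ h h'
    · have h1 : Apart S α γ :=
        ⟨disjoint_of_length_eq (hα.trans hγ.symm) hαγ, h.left, h'.left⟩
      rw [step hβ hγ h h1, map_fixSwap_comm φ h1, step hα hδ h1.symm h']
  let a : Fin n := ⟨0, by omega⟩
  let N := α.2.length + β.2.length + γ.2.length + δ.2.length
  rw [← map_fixSwap_app_of_odd φ hn hodd h (List.replicate (N - α.2.length) a)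
    (List.replicate (N - β.2.length) a), ← map_fixSwap_app_of_odd φ hn hodd h'
    (List.replicate (N - γ.2.length) a) (List.replicate (N - δ.2.length) a)]
  refine key (N := N) ?_ ?_ ?_ ?_ (h.app _ _) (h'.app _ _) <;> simp [N] <;> omega

end Classes

/-! ### Counting modulo two -/

/-- The number modulo two, with weights `k`, of the points `wψ₀` with `w` a prefix of length `N`.
For odd `n` and large `N` this is a finitely additive measure giving mass one to every cone, and
hence invariant under `V`. -/
noncomputable def integ (ψ₀ : ℕ → Fin n) (N : ℕ) (k : CantorSpace n r → ZMod 2) : ZMod 2 :=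
  ∑ w ∈ words n r N, k (prepend w ψ₀)

/-- The square of the measure `integ`. -/
noncomputable def integ₂ (ψ₀ : ℕ → Fin n) (N : ℕ)
    (K : CantorSpace n r → CantorSpace n r → ZMod 2) : ZMod 2 :=
  ∑ v ∈ words n r N, ∑ w ∈ words n r N, K (prepend v ψ₀) (prepend w ψ₀)

/-- `k x` depends on the prefix of length `M` of `x` only. -/
def HasDepth (M : ℕ) (k : CantorSpace n r → ZMod 2) : Prop :=
  ∀ x y, pre M x = pre M y → k x = k y

/-- `K x y` depends on the prefixes of length `M` of `x` and `y` only. -/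
def HasDepth₂ (M : ℕ) (K : CantorSpace n r → CantorSpace n r → ZMod 2) : Prop :=
  ∀ x x' y y', pre M x = pre M x' → pre M y = pre M y' → K x y = K x' y'

theorem sum_words_succ {M : Type*} [AddCommMonoid M] (N : ℕ) (F : FinPrefix n r → M) :
    ∑ w ∈ words n r (N + 1), F w = ∑ w ∈ words n r N, ∑ j, F (app w [j]) := by
  rw [← Finset.sum_product' (words n r N) Finset.univ fun w j => F (app w [j])]
  symm
  refine Finset.sum_bij (fun p _ => app p.1 [p.2]) ?_ ?_ ?_ ?_
  · intro p hp
    simp at hp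
    simp [hp]
  · rintro ⟨p, i⟩ hp ⟨q, j⟩ hq h
    simp only [app, Prod.mk.injEq] at h
    have := List.append_inj' h.2 rfl
    simp only [List.cons.injEq, and_true] at this
    exact Prod.ext (Prod.ext h.1 this.1) this.2
  · intro w hw
    rw [mem_words] at hw
    have hne : w.2 ≠ [] := by
      rintro h
      simp [h] at hw
    exact ⟨((w.1, w.2.dropLast), w.2.getLast hne), by simp [hw],
      Prod.ext rfl (List.dropLast_append_getLast hne)⟩
  · exact fun _ _ => rfl

theorem integ_eq_of_hasDepth (hodd : Odd n) (ψ₀ : ℕ → Fin n) {M N : ℕ} (h : M ≤ N)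
    {k : CantorSpace n r → ZMod 2} (hk : HasDepth M k) : integ ψ₀ N k = integ ψ₀ M k := by
  induction N, h using Nat.le_induction with
  | base => rfl
  | succ N h ih =>
    rw [← ih, integ, sum_words_succ]
    refine Finset.sum_congr rfl fun w hw => ?_
    rw [mem_words] at hw
    have h1 : ∀ j, k (prepend (app w [j]) ψ₀) = k (prepend w ψ₀) := fun j => by
      refine hk _ _ (pre_eq_of_le h ?_)
      rw [prepend_app, ← hw, pre_prepend, pre_prepend]
    simp only [h1, Finset.sum_const, Finset.card_univ, Fintype.card_fin, nsmul_eq_mul]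
    rw [(ZMod.natCast_eq_one_iff_odd).2 hodd, one_mul]

theorem integ_indicator_cone (hodd : Odd n) (ψ₀ : ℕ → Fin n) {N : ℕ} {α : FinPrefix n r}
    (h : α.2.length ≤ N) : integ ψ₀ N ((cone α).indicator 1) = 1 := by
  classical
  rw [integ_eq_of_hasDepth hodd ψ₀ h, integ]
  · rw [Finset.sum_eq_single_of_mem α (by simp)]
    · rw [Set.indicator_of_mem (prepend_mem_cone _ _)]
      rfl
    · intro w hw hne
      rw [mem_words] at hw
      exact Set.indicator_of_notMem
        (Set.disjoint_left.1 (disjoint_of_length_eq hw hne) (prepend_mem_cone _ _)) _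
  · intro x y hxy
    simp only [Set.indicator_apply, mem_cone_iff, hxy, Pi.one_apply]

theorem integ_eq_sum_of_isPartition (hodd : Odd n) (ψ₀ : ℕ → Fin n) {N : ℕ}
    {P : Finset (FinPrefix n r)} (hP : IsPartition P Set.univ) (hN : ∀ α ∈ P, α.2.length ≤ N)
    {k : CantorSpace n r → ZMod 2} (hk : ∀ α ∈ P, ∀ ψ, k (prepend α ψ) = k (prepend α ψ₀)) :
    integ ψ₀ N k = ∑ α ∈ P, k (prepend α ψ₀) := by
  classical
  have h1 : ∀ x, k x = ∑ α ∈ P, k (prepend α ψ₀) * (cone α).indicator 1 x := by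
    intro x
    obtain ⟨α, hα, ψ, rfl⟩ := hP.exists_mem x trivial
    rw [Finset.sum_eq_single_of_mem α hα, Set.indicator_of_mem (prepend_mem_cone _ _), hk α hα]
    · simp
    · intro β hβ hne
      rw [Set.indicator_of_notMem, mul_zero]
      exact Set.disjoint_right.1 (hP.disjoint hβ hα hne) (prepend_mem_cone _ _)
  rw [integ, Finset.sum_congr rfl fun w _ => h1 (prepend w ψ₀), Finset.sum_comm]
  refine Finset.sum_congr rfl fun α hα => ?_
  rw [← Finset.mul_sum]
  have := integ_indicator_cone hodd ψ₀ (hN α hα)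
  rw [integ] at this
  rw [this, mul_one]

theorem isPartition_words (N : ℕ) : IsPartition (words n r N) Set.univ where
  subset _ _ := Set.subset_univ _
  exists_mem x _ := ⟨pre N x, by simp, mem_cone_pre N x⟩
  eq_of_mem α hα β hβ x h1 h2 := by
    rw [mem_words] at hα hβ
    exact eq_of_mem_cone h1 h2 (hα.trans hβ.symm)

/-- Invariance of the measure: an element `g` of `V` carries a partition into cones to a partition
into cones, and all cones have mass one. -/
theorem exists_integ_comp (hn : 2 ≤ n) (hodd : Odd n) (ψ₀ : ℕ → Fin n) (g : V n r) (M : ℕ) :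
    ∃ N₀, ∀ N, N₀ ≤ N → ∀ k : CantorSpace n r → ZMod 2, HasDepth M k →
      integ ψ₀ N (fun x => k (g.1 x)) = integ ψ₀ N k := by
  obtain ⟨L, b, hb⟩ := exists_uniform g
  have hP := isPartition_words (n := n) (r := r) (L + M)
  have hbP : IsTable g (words n r (L + M)) b := fun α hα =>
    (hb α (by rw [mem_words] at hα; omega)).2
  have hQ := hbP.isPartition_image hP fun x hx => (hx trivial).elim
  have hk' : ∀ k : CantorSpace n r → ZMod 2, HasDepth M k → ∀ α ∈ words n r (L + M), ∀ ψ,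
      k (prepend (b α) ψ) = k (prepend (b α) ψ₀) := by
    intro k hk α hα ψ
    have h1 := (hb α (by rw [mem_words] at hα; omega)).1
    rw [mem_words] at hα
    refine hk _ _ (pre_eq_of_le (N := (b α).2.length) (by omega) ?_)
    rw [pre_prepend, pre_prepend]
  refine ⟨(L + M) + (words n r (L + M)).sup fun α => (b α).2.length, fun N hN k hk => ?_⟩
  rw [integ_eq_sum_of_isPartition hodd ψ₀ hP, integ_eq_sum_of_isPartition hodd ψ₀ hQ,
    Finset.sum_image (hbP.injOn hn hP)]
  · exact Finset.sum_congr rfl fun α hα => by rw [hbP α hα]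
  · simp only [Finset.forall_mem_image]
    intro α hα
    have := Finset.le_sup (f := fun α => (b α).2.length) hα
    omega
  · simp only [Finset.forall_mem_image]
    exact hk' k hk
  · intro α hα
    rw [mem_words] at hα
    omega
  · intro α hα ψ
    rw [hbP α hα, hbP α hα, hk' k hk α hα]

theorem exists_integ₂_comp (hn : 2 ≤ n) (hodd : Odd n) (ψ₀ : ℕ → Fin n) (g : V n r) {M : ℕ}
    {K : CantorSpace n r → CantorSpace n r → ZMod 2} (hK : HasDepth₂ M K) :
    ∃ N₀, ∀ N, N₀ ≤ N →
      integ₂ ψ₀ N (fun x y => K (g.1 x) (g.1 y)) = integ₂ ψ₀ N K := by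
  obtain ⟨N₀, hN₀⟩ := exists_integ_comp hn hodd ψ₀ g M
  refine ⟨N₀, fun N hN => ?_⟩
  have h1 : ∀ x, integ ψ₀ N (fun y => K x (g.1 y)) = integ ψ₀ N (K x) := fun x =>
    hN₀ N hN (K x) fun y y' h => hK _ _ _ _ rfl h
  have h2 : ∀ y, integ ψ₀ N (fun x => K (g.1 x) y) = integ ψ₀ N (fun x => K x y) := fun y =>
    hN₀ N hN (fun x => K x y) fun x x' h => hK _ _ _ _ h rfl
  simp only [integ] at h1 h2
  simp only [integ₂, h1]
  rw [Finset.sum_comm]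
  simp only [h2]
  rw [Finset.sum_comm]

theorem integ₂_eq_zero_of_symm (ψ₀ : ℕ → Fin n) (N : ℕ)
    {K : CantorSpace n r → CantorSpace n r → ZMod 2} (hs : ∀ x y, K x y = K y x)
    (h0 : ∀ x, K x x = 0) : integ₂ ψ₀ N K = 0 := by
  rw [integ₂, ← Finset.sum_product' _ _ fun v w => K (prepend v ψ₀) (prepend w ψ₀)]
  refine Finset.sum_involution (fun p _ => p.swap) ?_ ?_ ?_ ?_
  · intro p _
    rw [Prod.fst_swap, Prod.snd_swap, hs]
    exact CharTwo.add_self_eq_zero _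
  · rintro ⟨v, w⟩ _ hne h
    simp only [Prod.swap_prod_mk, Prod.mk.injEq] at h
    rw [h.1] at hne
    exact hne (h0 _)
  · intro p hp
    simp only [Finset.mem_product, Prod.fst_swap, Prod.snd_swap] at hp ⊢
    exact hp.symm
  · exact fun _ _ => Prod.swap_swap _

theorem integ₂_add (ψ₀ : ℕ → Fin n) (N : ℕ) (K K' : CantorSpace n r → CantorSpace n r → ZMod 2) :
    integ₂ ψ₀ N (fun x y => K x y + K' x y) = integ₂ ψ₀ N K + integ₂ ψ₀ N K' := by
  simp only [integ₂, Finset.sum_add_distrib]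

/-! ### The sign for odd `n` -/

/-- A point of the Cantor space as an element of the lexicographically ordered product. -/
def lexKey (x : CantorSpace n r) : Fin r ×ₗ Lex (ℕ → Fin n) := toLex (x.1, toLex x.2)

theorem lexKey_injective : Function.Injective (lexKey (n := n) (r := r)) := fun x y h => by
  simpa [lexKey, Prod.ext_iff] using h

theorem lexKey_lt_iff {x y : CantorSpace n r} : lexKey x < lexKey y ↔
    x.1 < y.1 ∨ x.1 = y.1 ∧ ∃ k, (∀ i < k, x.2 i = y.2 i) ∧ x.2 k < y.2 k := by
  rw [lexKey, lexKey, Prod.Lex.toLex_lt_toLex]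
  rfl

open Classical in
/-- The indicator function of the lexicographic order, with values modulo two. -/
noncomputable def lexInd (x y : CantorSpace n r) : ZMod 2 := if lexKey x < lexKey y then 1 else 0

theorem lexInd_congr {x y x' y' : CantorSpace n r}
    (h : lexKey x < lexKey y ↔ lexKey x' < lexKey y') : lexInd x y = lexInd x' y' := by
  simp only [lexInd, h]

theorem lexInd_self (x : CantorSpace n r) : lexInd x x = 0 := by
  simp [lexInd]

theorem lexInd_swap {x y : CantorSpace n r} (h : x ≠ y) : lexInd y x = lexInd x y + 1 := by
  rcases lt_or_gt_of_ne (lexKey_injective.ne h) with h | h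
  · rw [lexInd, lexInd, if_pos h, if_neg h.not_gt]
    rfl
  · rw [lexInd, lexInd, if_pos h, if_neg h.not_gt]
    rfl

theorem lexKey_prepend_lt_iff (α : FinPrefix n r) (ψ φ : ℕ → Fin n) :
    lexKey (prepend α ψ) < lexKey (prepend α φ) ↔ toLex ψ < toLex φ := by
  rw [lexKey_lt_iff]
  change _ ↔ ∃ k, (∀ i < k, ψ i = φ i) ∧ ψ k < φ k
  constructor
  · rintro (h | ⟨-, k, h1, h2⟩)
    · exact (lt_irrefl _ h).elim
    · have hk : α.2.length ≤ k := by
        by_contra! hk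
        rw [prepend_snd_of_lt _ _ hk, prepend_snd_of_lt _ _ hk] at h2
        exact lt_irrefl _ h2
      obtain ⟨k, rfl⟩ := Nat.exists_eq_add_of_le' hk
      refine ⟨k, fun i hi => ?_, ?_⟩
      · have := h1 (i + α.2.length) (by omega)
        rwa [prepend_snd_add, prepend_snd_add] at this
      · rwa [prepend_snd_add, prepend_snd_add] at h2
  · rintro ⟨k, h1, h2⟩
    refine Or.inr ⟨rfl, k + α.2.length, fun i hi => ?_, ?_⟩
    · rcases Nat.lt_or_ge i α.2.length with h | h
      · rw [prepend_snd_of_lt _ _ h, prepend_snd_of_lt _ _ h]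
      · obtain ⟨i, rfl⟩ := Nat.exists_eq_add_of_le' h
        rw [prepend_snd_add, prepend_snd_add, h1 i (by omega)]
    · rwa [prepend_snd_add, prepend_snd_add]

theorem lexKey_lt_of_pre_eq {M : ℕ} {x x' y y' : CantorSpace n r} (hx : pre M x = pre M x')
    (hy : pre M y = pre M y') (hne : pre M x ≠ pre M y) (h : lexKey x < lexKey y) :
    lexKey x' < lexKey y' := by
  rw [pre_eq_iff] at hx hy
  rw [Ne, pre_eq_iff] at hne
  rw [lexKey_lt_iff] at h ⊢
  rw [← hx.1, ← hy.1]
  refine h.imp id fun ⟨h1, k, h2, h3⟩ => ⟨h1, k, ?_⟩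
  have hk : k < M := by
    by_contra! hk
    exact hne ⟨h1, fun i hi => h2 i (by omega)⟩
  refine ⟨fun i hi => ?_, ?_⟩
  · rw [← hx.2 i (by omega), ← hy.2 i (by omega), h2 i hi]
  · rwa [← hx.2 k hk, ← hy.2 k hk]

theorem lexInd_eq_of_disjoint {α β : FinPrefix n r} (h : Disjoint (cone α) (cone β))
    {x x' y y' : CantorSpace n r} (hx : x ∈ cone α) (hx' : x' ∈ cone α) (hy : y ∈ cone β)
    (hy' : y' ∈ cone β) : lexInd x y = lexInd x' y' := by
  have hne : pre (min α.2.length β.2.length) x ≠ pre (min α.2.length β.2.length) y := by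
    intro he
    rcases le_total α.2.length β.2.length with hl | hl
    · rw [min_eq_left hl, mem_cone_iff.1 hx] at he
      exact Set.disjoint_left.1 h (mem_cone_iff.2 he.symm) hy
    · rw [min_eq_right hl, mem_cone_iff.1 hy] at he
      exact Set.disjoint_left.1 h hx (mem_cone_iff.2 he)
  have h1 : pre (min α.2.length β.2.length) x = pre (min α.2.length β.2.length) x' :=
    pre_eq_of_le (min_le_left _ _) ((mem_cone_iff.1 hx).trans (mem_cone_iff.1 hx').symm)
  have h2 : pre (min α.2.length β.2.length) y = pre (min α.2.length β.2.length) y' :=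
    pre_eq_of_le (min_le_right _ _) ((mem_cone_iff.1 hy).trans (mem_cone_iff.1 hy').symm)
  exact lexInd_congr ⟨lexKey_lt_of_pre_eq h1 h2 hne,
    lexKey_lt_of_pre_eq h1.symm h2.symm (by rwa [← h1, ← h2])⟩

/-- For `x ≠ y`, whether `f` changes the order of `x` and `y`. -/
noncomputable def reversal (f : V n r) (x y : CantorSpace n r) : ZMod 2 :=
  lexInd x y + lexInd (f.1 x) (f.1 y)

theorem reversal_self (f : V n r) (x : CantorSpace n r) : reversal f x x = 0 := by
  simp [reversal, lexInd_self]

theorem reversal_symm (f : V n r) (x y : CantorSpace n r) :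
    reversal f x y = reversal f y x := by
  by_cases h : x = y
  · rw [h]
  · rw [reversal, reversal, lexInd_swap h, lexInd_swap (f.1.injective.ne h)]
    linear_combination -(CharTwo.add_self_eq_zero (1 : ZMod 2))

theorem reversal_mul (f g : V n r) (x y : CantorSpace n r) :
    reversal (f * g) x y = reversal g x y + reversal f (g.1 x) (g.1 y) := by
  simp only [reversal, V.mul_apply]
  linear_combination -(CharTwo.add_self_eq_zero (lexInd (g.1 x) (g.1 y)))

theorem reversal_prepend (f : V n r) {α β : FinPrefix n r}
    (h : ∀ ψ, f.1 (prepend α ψ) = prepend β ψ) (ψ φ : ℕ → Fin n) :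
    reversal f (prepend α ψ) (prepend α φ) = 0 := by
  rw [reversal, h, h, lexInd_congr (x' := prepend β ψ) (y' := prepend β φ)]
  · exact CharTwo.add_self_eq_zero _
  · rw [lexKey_prepend_lt_iff, lexKey_prepend_lt_iff]

/-- The indicator function of the inversions of `f`: the pairs `x < y` with `f(x) > f(y)`. -/
noncomputable def inversion (f : V n r) (x y : CantorSpace n r) : ZMod 2 :=
  lexInd x y * reversal f x y

theorem exists_hasDepth₂_inversion (f : V n r) : ∃ M, HasDepth₂ M (inversion f) := by
  obtain ⟨M, b, hb⟩ := exists_uniform f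
  refine ⟨M, fun x x' y y' hx hy => ?_⟩
  have hb' : ∀ z : CantorSpace n r, ∀ ψ,
      f.1 (prepend (pre M z) ψ) = prepend (b (pre M z)) ψ := fun z => (hb _ (by simp)).2
  by_cases hxy : pre M x = pre M y
  · have h0 : ∀ x y, pre M x = pre M y → inversion f x y = 0 := by
      intro x y hxy
      have h := reversal_prepend f (hb' x) (tail M x) (tail M y)
      rw [prepend_pre_tail, hxy, prepend_pre_tail] at h
      rw [inversion, h, mul_zero]
    rw [h0 x y hxy, h0 x' y' (by rw [← hx, ← hy, hxy])]
  · have hd : Disjoint (cone (pre M x)) (cone (pre M y)) := disjoint_of_length_eq (by simp) hxy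
    have hd' : Disjoint (cone (b (pre M x))) (cone (b (pre M y))) := by
      refine Set.disjoint_left.2 fun z h1 h2 => ?_
      rw [← V.apply_inv_apply f z] at h1 h2
      exact Set.disjoint_left.1 hd ((apply_mem_cone_iff (hb' x)).1 h1)
        ((apply_mem_cone_iff (hb' y)).1 h2)
    have hx' : x' ∈ cone (pre M x) := mem_cone_pre_iff.2 hx.symm
    have hy' : y' ∈ cone (pre M y) := mem_cone_pre_iff.2 hy.symm
    rw [inversion, inversion, reversal, reversal,
      lexInd_eq_of_disjoint hd (mem_cone_pre M x) hx' (mem_cone_pre M y) hy',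
      lexInd_eq_of_disjoint hd' ((apply_mem_cone_iff (hb' x)).2 (mem_cone_pre M x))
        ((apply_mem_cone_iff (hb' x)).2 hx') ((apply_mem_cone_iff (hb' y)).2 (mem_cone_pre M y))
        ((apply_mem_cone_iff (hb' y)).2 hy')]

/-- The parity of the number of inversions is additive. The inversions of `f * g` differ from those
of `g` by the pairs `x < y` for which `f` reverses the order of `g x` and `g y`. By invariance these
may be counted as the pairs `(x, y)` with `g⁻¹ x < g⁻¹ y` whose order `f` reverses; replacing the
condition `g⁻¹ x < g⁻¹ y` by `x < y` changes the count by a symmetric function, whose sum is even. -/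
theorem exists_integ₂_inversion_mul (hn : 2 ≤ n) (hodd : Odd n) (ψ₀ : ℕ → Fin n) (f g : V n r) :
    ∃ N₀, ∀ N, N₀ ≤ N → integ₂ ψ₀ N (inversion (f * g)) =
      integ₂ ψ₀ N (inversion f) + integ₂ ψ₀ N (inversion g) := by
  let K : CantorSpace n r → CantorSpace n r → ZMod 2 :=
    fun x y => lexInd x y * reversal f (g.1 x) (g.1 y)
  have hK : ∀ x y, inversion (f * g) x y = inversion g x y + K x y := fun x y => by
    rw [inversion, inversion, reversal_mul]
    ring
  obtain ⟨M₁, h₁⟩ := exists_hasDepth₂_inversion (f * g)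
  obtain ⟨M₂, h₂⟩ := exists_hasDepth₂_inversion g
  have hKd : HasDepth₂ (max M₁ M₂) K := by
    intro x x' y y' hx hy
    have e1 := h₁ x x' y y' (pre_eq_of_le (le_max_left _ _) hx) (pre_eq_of_le (le_max_left _ _) hy)
    have e2 := h₂ x x' y y' (pre_eq_of_le (le_max_right _ _) hx)
      (pre_eq_of_le (le_max_right _ _) hy)
    rw [hK, hK, e2] at e1
    exact add_left_cancel e1
  obtain ⟨N₀, hN₀⟩ := exists_integ₂_comp hn hodd ψ₀ g⁻¹ hKd
  refine ⟨N₀, fun N hN => ?_⟩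
  have e1 : integ₂ ψ₀ N (inversion (f * g)) = integ₂ ψ₀ N (inversion g) + integ₂ ψ₀ N K := by
    rw [← integ₂_add]
    congr 1
    funext x y
    exact hK x y
  have e2 : integ₂ ψ₀ N (inversion f) + integ₂ ψ₀ N K = 0 := by
    rw [← hN₀ N hN, ← integ₂_add]
    have e3 : ∀ x y, inversion f x y + K ((g⁻¹).1 x) ((g⁻¹).1 y) =
        reversal g⁻¹ x y * reversal f x y := fun x y => by
      simp only [K, V.apply_inv_apply, inversion]
      rw [reversal.eq_def g⁻¹]
      ring
    simp only [e3]
    refine integ₂_eq_zero_of_symm ψ₀ N (fun x y => ?_) fun x => ?_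
    · rw [reversal_symm g⁻¹, reversal_symm f]
    · rw [reversal_self, zero_mul]
  rw [e1, eq_neg_of_add_eq_zero_left e2, CharTwo.neg_eq, add_comm]

/-- The sign homomorphism for odd `n`: the parity of the number of inversions among the points
`wψ₀`, with `w` of length `N`, as a germ at infinity in `N`. -/
noncomputable def sign (hn : 2 ≤ n) (hodd : Odd n) (ψ₀ : ℕ → Fin n) :
    V n r →* Multiplicative (Filter.Germ (Filter.atTop : Filter ℕ) (ZMod 2)) :=
  MonoidHom.mk' (fun f => Multiplicative.ofAdd
    ((fun N => integ₂ ψ₀ N (inversion f) : ℕ → ZMod 2) : Filter.Germ Filter.atTop (ZMod 2)))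
    fun f g => by
      obtain ⟨N₀, hN₀⟩ := exists_integ₂_inversion_mul hn hodd ψ₀ f g
      rw [← ofAdd_add, ← Filter.Germ.coe_add]
      refine congrArg _ (Filter.Germ.coe_eq.2 ?_)
      filter_upwards [Filter.eventually_ge_atTop N₀] with N hN
      exact hN₀ N hN

theorem mem_cone_singleton {a : Fin r} {i : Fin n} {x : CantorSpace n r} :
    x ∈ cone (a, [i]) ↔ x.1 = a ∧ x.2 0 = i := by
  rw [mem_cone_iff]
  simp [pre, Prod.ext_iff]

theorem lexKey_lt_iff_of_ne {x y : CantorSpace n r} (h : ¬(x.1 = y.1 ∧ x.2 0 = y.2 0)) :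
    lexKey x < lexKey y ↔ x.1 < y.1 ∨ x.1 = y.1 ∧ x.2 0 < y.2 0 := by
  rw [lexKey_lt_iff]
  refine or_congr Iff.rfl (and_congr_right fun h1 => ⟨?_, fun h2 => ⟨0, by simp, h2⟩⟩)
  rintro ⟨k, h2, h3⟩
  rcases k with _ | k
  · exact h3
  · exact (h ⟨h1, h2 0 (by omega)⟩).elim

theorem prepend_singleton (a : Fin r) (i : Fin n) (ψ : ℕ → Fin n) :
    (prepend (a, [i]) ψ).1 = a ∧ (prepend (a, [i]) ψ).2 0 = i := ⟨rfl, rfl⟩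

/-- The inversions of the transposition of two adjacent cones are the pairs formed by a point of the
first cone and a point of the second. -/
theorem inversion_swap (a : Fin r) {i j : Fin n} (hij : (i : ℕ) + 1 = j)
    (x y : CantorSpace n r) :
    inversion (swap (a, [i]) (a, [j])) x y =
      (cone (a, [i])).indicator 1 x * (cone (a, [j])).indicator 1 y := by
  have hne : i ≠ j := by
    rintro rfl
    omega
  have hd : Disjoint (cone ((a, [i]) : FinPrefix n r)) (cone (a, [j])) :=
    disjoint_of_length_eq rfl (by simpa using hne)
  have hfix : ∀ {z : CantorSpace n r}, z ∉ cone (a, [i]) → z ∉ cone (a, [j]) →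
      (swap (a, [i]) (a, [j])).1 z = z := fun h1 h2 => swap_of_notMem h1 h2
  -- a point outside both cones is on the same side of both
  have side : ∀ {z : CantorSpace n r} (ψ φ : ℕ → Fin n), z ∉ cone (a, [i]) → z ∉ cone (a, [j]) →
      lexInd z (prepend (a, [i]) ψ) = lexInd z (prepend (a, [j]) φ) ∧
      lexInd (prepend (a, [i]) ψ) z = lexInd (prepend (a, [j]) φ) z := by
    intro z ψ φ hi hj
    rw [mem_cone_singleton] at hi hj
    constructor <;> refine lexInd_congr ?_ <;> rw [lexKey_lt_iff_of_ne, lexKey_lt_iff_of_ne] <;>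
      simp only [prepend_singleton, Fin.lt_def, Fin.ext_iff] at * <;> omega
  have hx0 : ∀ {α β : FinPrefix n r}, Disjoint (cone α) (cone β) → ∀ ψ,
      (cone α).indicator (1 : CantorSpace n r → ZMod 2) (prepend β ψ) = 0 := fun h ψ =>
    Set.indicator_of_notMem (Set.disjoint_right.1 h (prepend_mem_cone _ _)) _
  by_cases hxi : x ∈ cone (a, [i])
  · obtain ⟨ψ, rfl⟩ := hxi
    rw [Set.indicator_of_mem (prepend_mem_cone _ _)]
    by_cases hyi : y ∈ cone (a, [i])
    · obtain ⟨φ, rfl⟩ := hyi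
      rw [hx0 hd.symm, inversion, reversal_prepend _ (swap_left hd), mul_zero, mul_zero]
    by_cases hyj : y ∈ cone (a, [j])
    · obtain ⟨φ, rfl⟩ := hyj
      have h1 : lexKey (prepend (a, [i]) ψ) < lexKey (prepend (a, [j]) φ) := by
        refine (lexKey_lt_iff_of_ne ?_).2 (Or.inr ⟨rfl, ?_⟩)
        · exact fun h => hne h.2
        · simp only [prepend_singleton, Fin.lt_def]
          omega
      have h2 : ¬lexKey (prepend (a, [j]) ψ) < lexKey (prepend (a, [i]) φ) := by
        rw [lexKey_lt_iff_of_ne] <;> simp only [prepend_singleton, Fin.lt_def, Fin.ext_iff] <;>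
          omega
      rw [Set.indicator_of_mem (prepend_mem_cone _ _), inversion, reversal, swap_left hd,
        swap_right hd, lexInd, lexInd, if_pos h1, if_neg h2]
      simp
    · rw [Set.indicator_of_notMem hyj, inversion, reversal, swap_left hd, hfix hyi hyj,
        (side ψ ψ hyi hyj).2, CharTwo.add_self_eq_zero, mul_zero, mul_zero]
  rw [Set.indicator_of_notMem hxi, zero_mul, inversion]
  by_cases hxj : x ∈ cone (a, [j])
  · obtain ⟨ψ, rfl⟩ := hxj
    by_cases hyi : y ∈ cone (a, [i])
    · obtain ⟨φ, rfl⟩ := hyi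
      have h2 : ¬lexKey (prepend (a, [j]) ψ) < lexKey (prepend (a, [i]) φ) := by
        rw [lexKey_lt_iff_of_ne] <;> simp only [prepend_singleton, Fin.lt_def, Fin.ext_iff] <;>
          omega
      rw [lexInd, if_neg h2, zero_mul]
    by_cases hyj : y ∈ cone (a, [j])
    · obtain ⟨φ, rfl⟩ := hyj
      rw [reversal_prepend _ (swap_right hd), mul_zero]
    · rw [reversal, swap_right hd, hfix hyi hyj, (side ψ ψ hyi hyj).2,
        CharTwo.add_self_eq_zero, mul_zero]
  · rw [reversal, hfix hxi hxj]
    by_cases hyi : y ∈ cone (a, [i])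
    · obtain ⟨φ, rfl⟩ := hyi
      rw [swap_left hd, (side φ φ hxi hxj).1, CharTwo.add_self_eq_zero, mul_zero]
    by_cases hyj : y ∈ cone (a, [j])
    · obtain ⟨φ, rfl⟩ := hyj
      rw [swap_right hd, (side φ φ hxi hxj).1, CharTwo.add_self_eq_zero, mul_zero]
    · rw [hfix hyi hyj, CharTwo.add_self_eq_zero, mul_zero]

theorem sign_swap_ne_one (hn : 2 ≤ n) (hodd : Odd n) (ψ₀ : ℕ → Fin n) (a : Fin r) {i j : Fin n}
    (hij : (i : ℕ) + 1 = j) : sign hn hodd ψ₀ (swap (a, [i]) (a, [j]) : V n r) ≠ 1 := by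
  intro h
  have h1 := Filter.Germ.coe_eq.1 (Multiplicative.ofAdd.injective h)
  obtain ⟨N, hN, hN1⟩ := (h1.and (Filter.eventually_ge_atTop 1)).exists
  have h2 : integ₂ ψ₀ N (inversion (swap (a, [i]) (a, [j]) : V n r)) = 1 := by
    simp only [integ₂, inversion_swap a hij, ← Finset.mul_sum, ← Finset.sum_mul]
    have h3 := integ_indicator_cone (r := r) hodd ψ₀ (α := (a, [i])) (by simpa using hN1)
    have h4 := integ_indicator_cone (r := r) hodd ψ₀ (α := (a, [j])) (by simpa using hN1)
    rw [integ] at h3 h4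
    rw [h3, h4, one_mul]
  simp only [h2] at hN
  exact one_ne_zero hN

/-! ### Germs -/

/-- Near `p`, the map `f` replaces the prefix of length `a` of `p` by the prefix of length `b`. -/
def ShiftsAt (p : CantorSpace n r) (f : V n r) (a b : ℕ) : Prop :=
  ∀ ψ, f.1 (prepend (pre a p) ψ) = prepend (pre b p) ψ

theorem exists_shiftsAt {p : CantorSpace n r} {f : V n r} (hf : f.1 p = p) :
    ∃ a b, ShiftsAt p f a b := by
  obtain ⟨α, β, ⟨φ, rfl⟩, h⟩ := f.2 p
  refine ⟨α.2.length, β.2.length, fun ψ => ?_⟩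
  have hβ : prepend α φ ∈ cone β := by
    rw [← hf, h]
    exact prepend_mem_cone _ _
  rw [mem_cone_iff.1 hβ, pre_prepend, h]

theorem ShiftsAt.add {p : CantorSpace n r} {f : V n r} (hf : f.1 p = p) {a b : ℕ}
    (h : ShiftsAt p f a b) (k : ℕ) : ShiftsAt p f (a + k) (b + k) := by
  obtain ⟨w, hw, hp⟩ := pre_add a k p
  have key : ∀ ψ, f.1 (prepend (pre (a + k) p) ψ) = prepend (app (pre b p) w) ψ := fun ψ => by
    rw [hp, prepend_app, prepend_app, h]
  have hmem : p ∈ cone (app (pre b p) w) := by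
    have h1 := (apply_mem_cone_iff key).2 (mem_cone_pre (a + k) p)
    rwa [hf] at h1
  rw [eq_of_mem_cone hmem (mem_cone_pre (b + k) p) (by simp [hw])] at key
  exact key

theorem ShiftsAt.eq (hn : 2 ≤ n) {p : CantorSpace n r} {f : V n r} (hf : f.1 p = p)
    {a b a' b' : ℕ} (h : ShiftsAt p f a b) (h' : ShiftsAt p f a' b') : b + a' = b' + a := by
  have h1 := h.add hf a'
  have h2 := h'.add hf a
  rw [add_comm a' a] at h2
  have h3 := eq_of_prepend_eq hn fun ψ => (h1 ψ).symm.trans (h2 ψ)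
  simpa using congrArg (fun α : FinPrefix n r => α.2.length) h3

theorem ShiftsAt.mul {p : CantorSpace n r} {f g : V n r} {a b c : ℕ} (hf : ShiftsAt p f b c)
    (hg : ShiftsAt p g a b) : ShiftsAt p (f * g) a c := fun ψ => by
  rw [V.mul_apply, hg, hf]

theorem shiftsAt_self_iff {p : CantorSpace n r} {f : V n r} {a : ℕ} :
    ShiftsAt p f a a ↔ ∀ x ∈ cone (pre a p), f.1 x = x := by
  constructor
  · rintro h _ ⟨ψ, rfl⟩
    exact h ψ
  · exact fun h ψ => h _ (prepend_mem_cone _ _)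

theorem apply_eq_of_mem_fixGroup_singleton {p : CantorSpace n r} (f : fixGroup {p}) :
    f.1.1 p = p := f.2 p rfl

/-- The amount by which an element fixing `p` lengthens the prefixes of `p`. -/
noncomputable def drift (p : CantorSpace n r) (f : fixGroup {p}) : ℤ :=
  ((exists_shiftsAt (apply_eq_of_mem_fixGroup_singleton f)).choose_spec.choose : ℤ) -
    (exists_shiftsAt (apply_eq_of_mem_fixGroup_singleton f)).choose

theorem drift_eq (hn : 2 ≤ n) {p : CantorSpace n r} {f : fixGroup {p}} {a b : ℕ}
    (h : ShiftsAt p f.1 a b) : drift p f = b - a := by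
  have hf := apply_eq_of_mem_fixGroup_singleton f
  have := (exists_shiftsAt hf).choose_spec.choose_spec.eq hn hf h
  rw [drift]
  omega

/-- The drift at `p` as a homomorphism. -/
noncomputable def driftHom (hn : 2 ≤ n) (p : CantorSpace n r) :
    fixGroup {p} →* Multiplicative ℤ :=
  MonoidHom.mk' (fun f => Multiplicative.ofAdd (drift p f)) fun f g => by
    rw [← ofAdd_add]
    congr 1
    have hf := apply_eq_of_mem_fixGroup_singleton f
    have hg := apply_eq_of_mem_fixGroup_singleton g
    obtain ⟨a, b, h⟩ := exists_shiftsAt hg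
    obtain ⟨c, d, h'⟩ := exists_shiftsAt hf
    have h1 := h.add hg c
    have h2 := h'.add hf b
    rw [add_comm c b] at h2
    rw [drift_eq hn h, drift_eq hn h', drift_eq hn (h2.mul h1)]
    push_cast
    ring

theorem ker_driftHom (hn : 2 ≤ n) (p : CantorSpace n r) :
    (driftHom hn p).ker = (fixGroup₀ {p}).subgroupOf (fixGroup {p}) := by
  ext f
  have hf := apply_eq_of_mem_fixGroup_singleton f
  rw [MonoidHom.mem_ker, Subgroup.mem_subgroupOf]
  change drift p f = 0 ↔ ∀ᶠ x in 𝓝ˢ {p}, f.1.1 x = x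
  rw [nhdsSet_singleton]
  constructor
  · intro h
    obtain ⟨a, b, hab⟩ := exists_shiftsAt hf
    rw [drift_eq hn hab] at h
    obtain rfl : b = a := by omega
    filter_upwards [cone_mem_nhds (mem_cone_pre b p)] with x hx
    exact shiftsAt_self_iff.1 hab x hx
  · intro h
    obtain ⟨N, hN⟩ := exists_cone_subset h
    rw [drift_eq hn (shiftsAt_self_iff.2 hN), sub_self]

/-- A prefix replacement at `p` extends to an element of `V` supported in a given cone around `p`:
exchange the smaller cone with a third one inside, and then the third one with the target. -/
theorem exists_mem_fixGroup_shiftsAt (hn : 2 ≤ n) {p : CantorSpace n r} {L a b : ℕ} (ha : L < a)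
    (hb : L < b) : ∃ g : V n r, g ∈ fixGroup (cone (pre L p))ᶜ ∧ ShiftsAt p g a b := by
  have : Nontrivial (Fin n) := Fin.nontrivial_iff_two_le.2 hn
  obtain ⟨k, hk⟩ := exists_ne (p.2 L)
  have hd : ∀ c, L < c → Disjoint (cone (pre c p)) (cone (app (pre L p) [k])) := by
    intro c hc
    refine Set.disjoint_left.2 ?_
    rintro _ h ⟨ψ, rfl⟩
    have h1 := (pre_eq_iff.1 (mem_cone_pre_iff.1 h)).2 L hc
    rw [prepend_snd_of_lt _ _ (by simp)] at h1
    simp [app, pre] at h1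
    exact hk h1
  have hsub : ∀ c, L < c → cone (pre c p) ⊆ cone (pre L p) := fun c hc x hx =>
    mem_cone_pre_iff.2 (pre_eq_of_le hc.le (mem_cone_pre_iff.1 hx))
  have hsub' := cone_app_subset (pre L p) [k]
  refine ⟨swap (app (pre L p) [k]) (pre b p) * swap (pre a p) (app (pre L p) [k]),
    mul_mem (swap_mem_fixGroup ?_ ?_) (swap_mem_fixGroup ?_ ?_), fun ψ => ?_⟩
  · exact Set.disjoint_compl_right_iff_subset.2 hsub'
  · exact Set.disjoint_compl_right_iff_subset.2 (hsub b hb)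
  · exact Set.disjoint_compl_right_iff_subset.2 (hsub a ha)
  · exact Set.disjoint_compl_right_iff_subset.2 hsub'
  · rw [V.mul_apply, swap_left (hd a ha), swap_left (hd b hb).symm]

theorem ShiftsAt.apply_eq {p : CantorSpace n r} {f : V n r} {a b : ℕ} (h : ShiftsAt p f a b)
    (ht : tail a p = tail b p) : f.1 p = p := by
  have := h (tail a p)
  rwa [prepend_pre_tail, ht, prepend_pre_tail] at this

theorem ShiftsAt.tail_eq {p : CantorSpace n r} {f : V n r} (hf : f.1 p = p) {a b : ℕ}
    (h : ShiftsAt p f a b) : tail a p = tail b p := by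
  have h1 := h (tail a p)
  rw [prepend_pre_tail, hf] at h1
  apply prepend_injective (pre b p)
  rw [← h1, prepend_pre_tail]

/-- Every germ at `p` is the germ of an element supported in a given neighborhood of `p`. -/
theorem exists_germ_eq (hn : 2 ≤ n) {p : CantorSpace n r} (c : GermGroup p)
    {U : Set (CantorSpace n r)} (hU : U ∈ 𝓝 p) :
    ∃ g : fixGroup {p}, g.1 ∈ fixGroup Uᶜ ∧ (g : GermGroup p) = c := by
  obtain ⟨f, rfl⟩ := QuotientGroup.mk_surjective c
  have hf := apply_eq_of_mem_fixGroup_singleton f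
  obtain ⟨L, hL⟩ := exists_cone_subset hU
  obtain ⟨a, b, hab⟩ := exists_shiftsAt hf
  obtain ⟨g, hg, hs⟩ := exists_mem_fixGroup_shiftsAt hn (p := p) (L := L)
    (a := a + (L + 1)) (b := b + (L + 1)) (by omega) (by omega)
  have hab' := hab.add hf (L + 1)
  have hgp : g.1 p = p := hs.apply_eq (hab'.tail_eq hf)
  let g' : fixGroup {p} := ⟨g, fun x hx => by rw [Set.mem_singleton_iff.1 hx, hgp]⟩
  refine ⟨g', fun x hx => hg x fun h => hx (hL h), ?_⟩
  rw [QuotientGroup.eq, ← ker_driftHom hn, MonoidHom.mem_ker, map_mul, map_inv]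
  change (Multiplicative.ofAdd (drift p g'))⁻¹ * Multiplicative.ofAdd (drift p f) = 1
  rw [drift_eq hn (f := g') hs, drift_eq hn hab', inv_mul_cancel]

theorem exists_drift_ne_zero (hn : 2 ≤ n) {p : CantorSpace n r} (hp : IsRational p) :
    ∃ f : fixGroup {p}, drift p f ≠ 0 := by
  obtain ⟨N, q, hq, h⟩ := hp
  have ht : tail (N + 1) p = tail (N + 1 + q) p := funext fun k => by
    have := h (k + (N + 1)) (by omega)
    simp only [tail]
    rw [← this, add_assoc]
  obtain ⟨g, -, hs⟩ := exists_mem_fixGroup_shiftsAt hn (p := p) (L := 0) (a := N + 1)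
    (b := N + 1 + q) (by omega) (by omega)
  refine ⟨⟨g, fun x hx => by rw [Set.mem_singleton_iff.1 hx, hs.apply_eq ht]⟩, ?_⟩
  rw [drift_eq hn hs]
  push_cast
  omega

/-- The group of germs at a rational point is isomorphic to the image of the drift, a nonzero
subgroup of `ℤ`. -/
theorem nonempty_germGroup_equiv (hn : 2 ≤ n) {p : CantorSpace n r} (hp : IsRational p) :
    Nonempty (Additive (GermGroup p) ≃+ ℤ) := by
  let e : GermGroup p ≃* (driftHom hn p).range :=
    (QuotientGroup.quotientMulEquivOfEq (ker_driftHom hn p).symm).trans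
      (QuotientGroup.quotientKerEquivRange (driftHom hn p))
  obtain ⟨f, hf⟩ := exists_drift_ne_zero hn hp
  have : Infinite (driftHom hn p).range := by
    refine Infinite.of_injective
      (fun k : ℤ => (⟨driftHom hn p f ^ k,
        Subgroup.zpow_mem _ (MonoidHom.mem_range.2 ⟨f, rfl⟩) k⟩ : (driftHom hn p).range)) ?_
    intro k l hkl
    have h1 : driftHom hn p f ^ k = driftHom hn p f ^ l := congrArg Subtype.val hkl
    have h2 : k * drift p f = l * drift p f := by
      have h3 := congrArg Multiplicative.toAdd h1
      rwa [toAdd_zpow, toAdd_zpow, smul_eq_mul, smul_eq_mul] at h3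
    exact mul_right_cancel₀ hf h2
  exact ⟨MulEquiv.toAdditiveLeft (e.trans intCyclicMulEquiv.symm)⟩

theorem germ_eq_one_iff {S : Set (CantorSpace n r)} {p : S} {f : fixGroup S} :
    germ S p f = 1 ↔ ∀ᶠ x in 𝓝 (p : CantorSpace n r), f.1.1 x = x := by
  change ((_ : fixGroup {p.1}) : GermGroup p.1) = 1 ↔ _
  rw [QuotientGroup.eq_one_iff, Subgroup.mem_subgroupOf]
  change (∀ᶠ x in 𝓝ˢ {p.1}, f.1.1 x = x) ↔ _
  rw [nhdsSet_singleton]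

theorem isClosed_cone (α : FinPrefix n r) : IsClosed (cone α) :=
  (isCompact_range (continuous_prepend α)).isClosed

theorem germ_fixSwap {S : Set (CantorSpace n r)} {α β : FinPrefix n r} (h : Apart S α β) (p : S) :
    germ S p (fixSwap S α β) = 1 := by
  rw [germ_eq_one_iff, coe_fixSwap h]
  filter_upwards [(isClosed_cone α).isOpen_compl.mem_nhds (Set.disjoint_right.1 h.left p.2),
    (isClosed_cone β).isOpen_compl.mem_nhds (Set.disjoint_right.1 h.right p.2)] with x h1 h2
  exact swap_of_notMem h1 h2

/-! ### The abelianization of `V` -/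

section Generation

variable {S : Set (CantorSpace n r)} {B : Type*} [CommGroup B] (φ : fixGroup S →* B)

theorem map_mem_of_mem_closure {H : Subgroup B}
    (hH : ∀ α β, Apart S α β → φ (fixSwap S α β) ∈ H) {f : fixGroup S}
    (hf : f.1 ∈ Subgroup.closure (swapsIn Sᶜ)) : φ f ∈ H := by
  have h1 : Subgroup.closure (swapsIn Sᶜ) ≤ (H.comap φ).map (fixGroup S).subtype := by
    rw [Subgroup.closure_le]
    rintro _ ⟨α, β, hd, hα, hβ, rfl⟩
    have h : Apart S α β := ⟨hd, Set.subset_compl_iff_disjoint_right.1 hα,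
      Set.subset_compl_iff_disjoint_right.1 hβ⟩
    exact ⟨fixSwap S α β, hH α β h, coe_fixSwap h⟩
  obtain ⟨g, hg, hgf⟩ := h1 hf
  rwa [← Subtype.ext hgf]

theorem map_eq_one_of_even (hn : 2 ≤ n) (hev : Even n) {f : fixGroup S}
    (hf : f.1 ∈ Subgroup.closure (swapsIn Sᶜ)) : φ f = 1 := by
  rw [← Subgroup.mem_bot]
  refine map_mem_of_mem_closure φ (fun α β h => ?_) hf
  rw [Subgroup.mem_bot, map_fixSwap_of_even φ hn hev h]

theorem map_eq_one_or_of_odd (hn : 2 ≤ n) (hodd : Odd n) {α β : FinPrefix n r} (h : Apart S α β)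
    {f : fixGroup S} (hf : f.1 ∈ Subgroup.closure (swapsIn Sᶜ)) :
    φ f = 1 ∨ φ f = φ (fixSwap S α β) := by
  have h1 : φ f ∈ Subgroup.zpowers (φ (fixSwap S α β)) :=
    map_mem_of_mem_closure φ (fun γ δ h' => by
      rw [map_fixSwap_eq_of_odd φ hn hodd h' h]
      exact Subgroup.mem_zpowers _) hf
  obtain ⟨k, hk⟩ := h1
  have h2 := map_fixSwap_mul_self φ h
  simp only at hk
  rcases Int.even_or_odd' k with ⟨m, rfl | rfl⟩
  · left
    rw [← hk, zpow_mul, zpow_two, h2, one_zpow]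
  · right
    rw [← hk, zpow_add_one, zpow_mul, zpow_two, h2, one_zpow, one_mul]

end Generation

theorem mem_closure_swapsIn_univ (hn : 2 ≤ n) (f : V n r) :
    f ∈ Subgroup.closure (swapsIn (∅ : Set (CantorSpace n r))ᶜ) :=
  mem_closure_swapsIn_compl hn Set.finite_empty fun _ hp => hp.elim

theorem Apart.of_disjoint {α β : FinPrefix n r} (h : Disjoint (cone α) (cone β)) :
    Apart ∅ α β := ⟨h, Set.disjoint_empty _, Set.disjoint_empty _⟩

theorem sign_swap_ne_one_of_disjoint (hn : 2 ≤ n) (hodd : Odd n) (ψ₀ : ℕ → Fin n)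
    {α β : FinPrefix n r} (h : Disjoint (cone α) (cone β)) :
    sign hn hodd ψ₀ (swap α β) ≠ 1 := by
  let i : Fin n := ⟨0, by omega⟩
  let j : Fin n := ⟨1, by omega⟩
  have hij : Disjoint (cone ((α.1, [i]) : FinPrefix n r)) (cone (α.1, [j])) :=
    disjoint_of_length_eq rfl (by simp [i, j])
  have h1 := map_fixSwap_eq_of_odd ((sign hn hodd ψ₀).comp (fixGroup ∅).subtype) hn hodd
    (Apart.of_disjoint h) (Apart.of_disjoint hij)
  rw [MonoidHom.comp_apply, MonoidHom.comp_apply, Subgroup.coe_subtype,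
    coe_fixSwap (Apart.of_disjoint h), coe_fixSwap (Apart.of_disjoint hij)] at h1
  rw [h1]
  exact sign_swap_ne_one hn hodd ψ₀ α.1 rfl

theorem subsingleton_abelianization (hn : 2 ≤ n) (hev : Even n) :
    Subsingleton (Abelianization (V n r)) := by
  refine subsingleton_of_forall_eq 1 fun x => ?_
  obtain ⟨f, rfl⟩ : ∃ f, Abelianization.of f = x := QuotientGroup.mk_surjective x
  exact map_eq_one_of_even ((Abelianization.of).comp (fixGroup ∅).subtype) hn hev
    (f := ⟨f, fun _ h => h.elim⟩) (mem_closure_swapsIn_univ hn f)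

theorem abelianization_eq_one_or (hn : 2 ≤ n) (hodd : Odd n) {α β : FinPrefix n r}
    (h : Disjoint (cone α) (cone β)) (x : Abelianization (V n r)) :
    x = 1 ∨ x = Abelianization.of (swap α β) := by
  obtain ⟨f, rfl⟩ : ∃ f, Abelianization.of f = x := QuotientGroup.mk_surjective x
  have := map_eq_one_or_of_odd ((Abelianization.of).comp (fixGroup ∅).subtype) hn hodd
    (Apart.of_disjoint h) (f := ⟨f, fun _ h => h.elim⟩) (mem_closure_swapsIn_univ hn f)
  rwa [MonoidHom.comp_apply, MonoidHom.comp_apply, Subgroup.coe_subtype,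
    coe_fixSwap (Apart.of_disjoint h)] at this

theorem of_swap_ne_one (hn : 2 ≤ n) (hodd : Odd n) {α β : FinPrefix n r}
    (h : Disjoint (cone α) (cone β)) : Abelianization.of (swap α β) ≠ 1 := fun h1 => by
  refine sign_swap_ne_one_of_disjoint hn hodd (fun _ => ⟨0, by omega⟩) h ?_
  rw [← Abelianization.lift_apply_of (sign hn hodd _), h1, map_one]

theorem nonempty_abelianization_equiv (hn : 2 ≤ n) (hr : 1 ≤ r) (hodd : Odd n) :
    Nonempty (Additive (Abelianization (V n r)) ≃+ ZMod 2) := by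
  let i : Fin n := ⟨0, by omega⟩
  let j : Fin n := ⟨1, by omega⟩
  have hij : Disjoint (cone (app ((⟨0, hr⟩, []) : FinPrefix n r) [i])) (cone (app _ [j])) :=
    disjoint_child _ (by simp [i, j])
  have hcard : Nat.card (Abelianization (V n r)) = 2 := by
    refine Nat.card_eq_two_iff.2 ⟨1, _, (of_swap_ne_one hn hodd hij).symm, ?_⟩
    exact Set.eq_univ_of_forall (abelianization_eq_one_or hn hodd hij)
  have hcard' : Nat.card (Multiplicative (ZMod 2)) = 2 := Nat.card_zmod 2
  exact ⟨MulEquiv.toAdditiveLeft (mulEquivOfPrimeCardEq hcard hcard')⟩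

/-! ### The abelianization of `Fix(S)` -/

/-- The homomorphism from `Fix(S)` to the product of the groups of germs at the points of `S` and
the abelianization of `V`. -/
noncomputable def germsHom (S : Set (CantorSpace n r)) :
    fixGroup S →* ((p : S) → GermGroup (p : CantorSpace n r)) × Abelianization (V n r) :=
  (MonoidHom.pi (germ S)).prod (Abelianization.of.comp (fixGroup S).subtype)

theorem exists_apart (hn : 2 ≤ n) (hr : 1 ≤ r) {S : Set (CantorSpace n r)} (hS : S.Finite) :
    ∃ α β : FinPrefix n r, Apart S α β := by
  have : Nontrivial (Fin n) := Fin.nontrivial_iff_two_le.2 hn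
  have : Nonempty (Fin r) := ⟨⟨0, hr⟩⟩
  obtain ⟨x, hx⟩ := hS.exists_notMem
  obtain ⟨N, hN⟩ := exists_cone_subset (hS.isClosed.isOpen_compl.mem_nhds hx)
  obtain ⟨i, j, hij⟩ := exists_pair_ne (Fin n)
  exact ⟨_, _, Apart.children (Set.subset_compl_iff_disjoint_right.1 hN) hij⟩

/-- An element with trivial germs on `S` is a product of transpositions away from `S`; for odd `n`
its class is that of a single transposition or trivial, and the sign distinguishes the two cases
already in the abelianization of `V`. -/
theorem of_eq_one_of_germsHom_eq_one (hn : 2 ≤ n) (hr : 1 ≤ r) {S : Set (CantorSpace n r)}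
    (hS : S.Finite) {f : fixGroup S} (hf : germsHom S f = 1) : Abelianization.of f = 1 := by
  have h1 : ∀ p : S, germ S p f = 1 := fun p => congrFun (congrArg Prod.fst hf) p
  have h2 : Abelianization.of f.1 = 1 := congrArg Prod.snd hf
  have h3 : f.1 ∈ Subgroup.closure (swapsIn Sᶜ) :=
    mem_closure_swapsIn_compl hn hS fun p hp => germ_eq_one_iff.1 (h1 ⟨p, hp⟩)
  rcases Nat.even_or_odd n with hev | hodd
  · exact map_eq_one_of_even _ hn hev h3
  · obtain ⟨α, β, h⟩ := exists_apart hn hr hS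
    rcases map_eq_one_or_of_odd
      (Abelianization.of.prod (Abelianization.of.comp (fixGroup S).subtype)) hn hodd h h3
      with h4 | h4
    · exact congrArg Prod.fst h4
    · have h5 := congrArg Prod.snd h4
      simp only [MonoidHom.prod_apply, MonoidHom.comp_apply, Subgroup.coe_subtype, h2,
        coe_fixSwap h] at h5
      exact (of_swap_ne_one hn hodd h.disj h5.symm).elim

theorem ker_germsHom (hn : 2 ≤ n) (hr : 1 ≤ r) {S : Set (CantorSpace n r)} (hS : S.Finite)
    (hrat : ∀ p ∈ S, IsRational p) : (germsHom S).ker = commutator (fixGroup S) := by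
  refine le_antisymm (fun f hf => ?_) fun f hf => ?_
  · rw [← Abelianization.ker_of]
    exact of_eq_one_of_germsHom_eq_one hn hr hS hf
  · refine Prod.ext (funext fun p => ?_) ?_
    · obtain ⟨e⟩ := nonempty_germGroup_equiv hn (hrat p.1 p.2)
      let ψ : fixGroup S →* Multiplicative ℤ :=
        (AddMonoidHom.toMultiplicativeRight e.toAddMonoidHom).comp (germ S p)
      have h1 : ψ f = 1 := Abelianization.commutator_subset_ker ψ hf
      exact e.map_eq_zero_iff.1 h1
    · exact Abelianization.commutator_subset_ker
        (Abelianization.of.comp (fixGroup S).subtype) hf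

theorem germsHom_surjective (hn : 2 ≤ n) (hr : 1 ≤ r) {S : Set (CantorSpace n r)}
    (hS : S.Finite) : Function.Surjective (germsHom S) := by
  classical
  have : Finite S := hS
  have hA : ∀ x, (1, x) ∈ (germsHom S).range := by
    intro x
    rcases Nat.even_or_odd n with hev | hodd
    · have := subsingleton_abelianization (r := r) hn hev
      rw [Subsingleton.elim x 1]
      exact one_mem _
    · obtain ⟨α, β, h⟩ := exists_apart hn hr hS
      rcases abelianization_eq_one_or hn hodd h.disj x with rfl | rfl
      · exact one_mem _
      · refine ⟨fixSwap S α β, Prod.ext (funext fun p => germ_fixSwap h p) ?_⟩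
        exact congrArg Abelianization.of (coe_fixSwap h)
  have hG : ∀ p c, ∃ x, (Pi.mulSingle p c, x) ∈ (germsHom S).range := by
    intro p c
    have hopen : IsOpen (S \ {p.1})ᶜ := (hS.subset Set.sdiff_subset).isClosed.isOpen_compl
    obtain ⟨L, hL⟩ := exists_cone_subset (hopen.mem_nhds (x := p.1) (by simp))
    obtain ⟨g, hg, hgc⟩ := exists_germ_eq hn c (cone_mem_nhds (mem_cone_pre L p.1))
    have hgS : g.1 ∈ fixGroup S := fun q hq => by
      by_cases hqp : q = p.1
      · exact g.2 q hqp
      · exact hg q fun h => hL h ⟨hq, hqp⟩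
    refine ⟨_, ⟨g.1, hgS⟩, Prod.ext (funext fun q => ?_) rfl⟩
    change germ S q ⟨g.1, hgS⟩ = (Pi.mulSingle p c : (p : S) → GermGroup p.1) q
    by_cases hqp : q = p
    · subst hqp
      rw [Pi.mulSingle_eq_same, ← hgc]
      rfl
    · rw [Pi.mulSingle_eq_of_ne hqp, germ_eq_one_iff]
      have hq : q.1 ∉ cone (pre L p.1) := fun h => hL h ⟨q.2, fun h' => hqp (Subtype.ext h')⟩
      filter_upwards [(isClosed_cone _).isOpen_compl.mem_nhds hq] with x hx
      exact hg x hx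
  rintro ⟨c, x⟩
  have hc : c ∈ (germsHom S).range.comap (MonoidHom.inl _ _) := by
    refine Subgroup.pi_mem_of_mulSingle_mem c fun p => ?_
    obtain ⟨y, hy⟩ := hG p (c p)
    have := mul_mem hy (hA y⁻¹)
    rwa [Prod.mk_mul_mk, mul_one, mul_inv_cancel] at this
  have := mul_mem (show (c, 1) ∈ (germsHom S).range from hc) (hA x)
  rwa [Prod.mk_mul_mk, mul_one, one_mul] at this

/-- The isomorphism between the abelianization of `Fix(S)` and the product of the groups of germs
and the abelianization of `V`. -/
noncomputable def abelianizationEquiv (hn : 2 ≤ n) (hr : 1 ≤ r) {S : Set (CantorSpace n r)}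
    (hS : S.Finite) (hrat : ∀ p ∈ S, IsRational p) : Abelianization (fixGroup S) ≃*
      ((p : S) → GermGroup (p : CantorSpace n r)) × Abelianization (V n r) :=
  (QuotientGroup.quotientMulEquivOfEq (ker_germsHom hn hr hS hrat).symm).trans
    (QuotientGroup.quotientKerEquivOfSurjective (germsHom S) (germsHom_surjective hn hr hS))

theorem nonempty_abelianization_fixGroup_equiv (hn : 2 ≤ n) (hr : 1 ≤ r)
    {S : Set (CantorSpace n r)} (hS : S.Finite) (hrat : ∀ p ∈ S, IsRational p) :
    Nonempty (Additive (Abelianization (fixGroup S)) ≃+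
      (Fin S.ncard → ℤ) × Additive (Abelianization (V n r))) := by
  have : Finite S := hS
  let e := fun p : S => (nonempty_germGroup_equiv hn (hrat p.1 p.2)).some
  exact ⟨((abelianizationEquiv hn hr hS hrat).toAdditive.trans (AddEquiv.prodAdditive _ _)).trans
    ((((AddEquiv.piAdditive _).trans (AddEquiv.piCongrRight e)).trans
      (AddEquiv.arrowCongr (Finite.equivFin S) (AddEquiv.refl ℤ))).prodCongr (AddEquiv.refl _))⟩

end HigmanThompson

theorem mainTheorem4 (n r : ℕ) (hn : 2 ≤ n) (hr : 1 ≤ r)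
    (S : Set (HigmanThompson.CantorSpace n r)) (hS : S.Finite)
    (hrat : ∀ p ∈ S, HigmanThompson.IsRational p) :
    -- the abelianization of `Fix(S)`
    (Even n → Nonempty
      (Additive (Abelianization (HigmanThompson.fixGroup S)) ≃+ (Fin S.ncard → ℤ))) ∧
    (Odd n → Nonempty
      (Additive (Abelianization (HigmanThompson.fixGroup S)) ≃+ ((Fin S.ncard → ℤ) × ZMod 2))) ∧
    -- it is induced by the germs at the points of `S` and the abelianization map of `V_{n,r}`
    (∃ e : Abelianization (HigmanThompson.fixGroup S) ≃*
        (((p : S) → HigmanThompson.GermGroup (p : HigmanThompson.CantorSpace n r)) ×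
          Abelianization (HigmanThompson.V n r)),
      ∀ f : HigmanThompson.fixGroup S, e (Abelianization.of f) =
        (fun p => HigmanThompson.germ S p f,
          Abelianization.of (f : HigmanThompson.V n r))) ∧
    -- where each group of germs is infinite cyclic and the abelianization of `V_{n,r}` is
    -- trivial or of order two
    (∀ p ∈ S, Nonempty (Additive (HigmanThompson.GermGroup p) ≃+ ℤ)) ∧
    (Even n → Subsingleton (Abelianization (HigmanThompson.V n r))) ∧
    (Odd n → Nonempty (Additive (Abelianization (HigmanThompson.V n r)) ≃+ ZMod 2)) := by
  obtain ⟨e⟩ := HigmanThompson.nonempty_abelianization_fixGroup_equiv hn hr hS hrat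
  refine ⟨fun hev => ?_, fun hodd => ?_,
    ⟨HigmanThompson.abelianizationEquiv hn hr hS hrat, fun _ => rfl⟩,
    fun p hp => HigmanThompson.nonempty_germGroup_equiv hn (hrat p hp),
    HigmanThompson.subsingleton_abelianization hn,
    HigmanThompson.nonempty_abelianization_equiv hn hr⟩
  · have := HigmanThompson.subsingleton_abelianization (r := r) hn hev
    have : Unique (Additive (Abelianization (HigmanThompson.V n r))) :=
      ⟨⟨0⟩, fun x => Subsingleton.elim (α := Abelianization (HigmanThompson.V n r)) x 1⟩
    exact ⟨e.trans AddEquiv.prodUnique⟩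
  · obtain ⟨e'⟩ := HigmanThompson.nonempty_abelianization_equiv (r := r) hn hr hodd
    exact ⟨e.trans ((AddEquiv.refl _).prodCongr e')⟩
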